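/- For a continuous driver $\lambda:[0,\infty)\to\mathbb C$ and $z\in\mathbb C$ consider the Loewner equation $\partial_t g_t(z)=\frac{2}{g_t(z)-\lambda(t)}$, $g_0(z)=z$. Let $T_z\in[0,\infty]$ be its blow-up time, i.e. the time $t$ at which $\lim_{s\uparrow t}|g_s(z)-\lambda(s)|=0$ ($T_{\lambda(0)}=0$, and $T_z=\infty$ if there is no such time), and let $L_t=\{z\in\mathbb C: T_z\le t\}$ be the left hull. We say that $\lambda$ creates a two-sided curve $\gamma$ if $\gamma:\mathbb R\to\mathbb C$ is continuous, $\gamma(0)=\lambda(0)$ and $L_t=\gamma([-t,t])$ for all $t\ge 0$. For $c\in\mathbb C$ let $\lambda_c(t)=ct$. Every $\lambda_c$, $c\in\mathbb C$, creates a two-sided curve. Moreover, $\mathbb C$ is the disjoint union of the following three sets of parameters, each of which is characterized by the stated geometry of the curve; the orientation of $\gamma$ is chosen suitably. (i) Simple phase. $\lambda_c$ creates an injective two-sided curve $\gamma$ with $|\gamma(t)|\to\infty$ as $t\to+\infty$ and as $t\to-\infty$ if and only if $(\operatorname{Re}c)^2-(\operatorname{Im}c)^2>0$ or $c=0$. (ii)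 Simple phase with one spiraling end. $\lambda_c$ creates an injective two-sided curve $\gamma$ with $|\gamma(t)|\to\infty$ and $\gamma(-t)\to p$ as $t\to+\infty$, for some point $p\in\mathbb C$ that is not on $\gamma$, if and only if $(\operatorname{Re}c)^2-(\operatorname{Im}c)^2<0$. For every such $\gamma$ one has $p=2/c$. If $\operatorname{Re}c\ne0$, then the end $\gamma(-t)$ spirals into $p$: a continuous argument of $\gamma(-t)-p$, $t\ge0$, tends to $+\infty$ or to $-\infty$ as $t\to+\infty$. If $\operatorname{Re}c=0$, the spiral is degenerate: $\gamma(-t)$ lies on the segment $[0,p]$ for all $t\ge 0$. (iii) Exotic phase. One has $(\operatorname{Re}c)^2-(\operatorname{Im}c)^2=0$ and $c\neq0$ if and only if $\lambda_c$ creates a two-sided curve $\gamma$ with the following properties for some $T>0$: $\gamma$ is injective on $[0,\infty)$ with $|\gamma(t)|\to\infty$ as $t\to+\infty$; $\gamma$ restricted to $[-T,0]$ is a Jordan curve $J$ rooted at $0$ (that is, $\gamma(-T)=\gamma(0)=0$ and $\gamma$ is injective on $(-T,0]$); $\gamma(s)=0$ for all $s\le -T$; $\gamma([0,\infty))\cap\gamma((-\infty,0])=\{0\}$;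 and the interior $U$ of $J$ (the union of the bounded components of $\mathbb C\setminus J$) is open, connected, bounded and of positive area, is disjoint from $L_t$ for all $t\ge0$, and is a connected component of $\mathbb C\setminus L_t$ for all $t\ge T$. For every such $\gamma$ and $T$ one has $T=4\pi/|c|^2$. -/

import Mathlib

open Set Filter Topology MeasureTheory

noncomputable section

/-- `g` solves the Loewner equation `∂ₜ g = 2 / (g - lam)`, `g 0 = z`, on the time interval
`[0, T)`, and stays away from the singularity there. -/
structure IsLoewnerSolution (lam : ℝ → ℂ) (z : ℂ) (T : ℝ) (g : ℝ → ℂ) : Prop where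
  initial : g 0 = z
  ne_driver : ∀ t ∈ Ico 0 T, g t ≠ lam t
  hasDeriv : ∀ t ∈ Ico 0 T, HasDerivWithinAt g (2 / (g t - lam t)) (Ico 0 T) t

/-- The solution started at `z` hits the driver at time `T`. The point `z = lam 0` does so
at time `0`; any other point does so at `T > 0` if its solution lives on `[0, T)` and
`g s - lam s → 0` as `s ↑ T`. -/
def BlowsUpAt (lam : ℝ → ℂ) (z : ℂ) (T : ℝ) : Prop :=
  (T = 0 ∧ z = lam 0) ∨
    (0 < T ∧ ∃ g : ℝ → ℂ, IsLoewnerSolution lam z T g ∧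
      Tendsto (fun s => g s - lam s) (𝓝[<] T) (𝓝 0))

/-- The blow-up time `T_z`, equal to `⊤` if there is no blow-up. -/
def blowUpTime (lam : ℝ → ℂ) (z : ℂ) : EReal :=
  sInf {τ : EReal | ∃ T : ℝ, τ = (T : EReal) ∧ BlowsUpAt lam z T}

/-- The left hull `L_t = {z : T_z ≤ t}`. -/
def leftHull (lam : ℝ → ℂ) (t : ℝ) : Set ℂ :=
  {z | blowUpTime lam z ≤ (t : EReal)}

/-- The complex linear driver `t ↦ c t`. -/
def linearDriver (c : ℂ) : ℝ → ℂ := fun t => c * (t : ℂ)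

/-- `lam` creates the two-sided curve `γ : ℝ → ℂ`: the curve starts at `lam 0`, and the left
hull at time `t` is what its two ends have traced up to time `t`. -/
structure CreatesTwoSidedCurve (lam : ℝ → ℂ) (γ : ℝ → ℂ) : Prop where
  continuous : Continuous γ
  start : γ 0 = lam 0
  hull : ∀ t : ℝ, 0 ≤ t → leftHull lam t = γ '' Icc (-t) t

/-- The two-sided curve is simple, and both ends run to infinity. -/
structure IsSimpleCurve (lam : ℝ → ℂ) (γ : ℝ → ℂ) : Prop where
  creates : CreatesTwoSidedCurve lam γ
  injective : Function.Injective γ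
  tendsto_pos : Tendsto γ atTop (Bornology.cobounded ℂ)
  tendsto_neg : Tendsto (fun t => γ (-t)) atTop (Bornology.cobounded ℂ)

/-- The two-sided curve is simple, one end runs to infinity, and the other one (here the negative
one, which is a choice of orientation) converges to a point `p` off the curve. -/
structure IsSimpleCurveEndingAt (lam : ℝ → ℂ) (γ : ℝ → ℂ) (p : ℂ) : Prop where
  creates : CreatesTwoSidedCurve lam γ
  injective : Function.Injective γ
  tendsto_pos : Tendsto γ atTop (Bornology.cobounded ℂ)
  tendsto_neg : Tendsto (fun t => γ (-t)) atTop (𝓝 p)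
  notMem : p ∉ range γ

/-- `η t`, `t ≥ 0`, winds infinitely often around `p` as `t → ∞`: a continuous argument of
`η t - p` tends to `+∞` or to `-∞`. -/
def WindsInfinitely (η : ℝ → ℂ) (p : ℂ) : Prop :=
  ∃ θ : ℝ → ℝ, ContinuousOn θ (Ici 0) ∧
    (∀ t : ℝ, 0 ≤ t → η t - p = (‖η t - p‖ : ℂ) * Complex.exp ((θ t : ℂ) * Complex.I)) ∧
    (Tendsto θ atTop atTop ∨ Tendsto θ atTop atBot)

/-- The part of the complement of `J` that `J` disconnects from infinity: the union of
the bounded connected components of the complement. -/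
def interiorOf (J : Set ℂ) : Set ℂ :=
  {z | z ∉ J ∧ Bornology.IsBounded (connectedComponentIn Jᶜ z)}

/-- `γ` restricted to `[a, b]` is a Jordan curve rooted at `p`. -/
structure IsJordanCurveOn (γ : ℝ → ℂ) (a b : ℝ) (p : ℂ) : Prop where
  lt : a < b
  continuousOn : ContinuousOn γ (Icc a b)
  left : γ a = p
  right : γ b = p
  injOn : InjOn γ (Ioc a b)

/-- The exotic two-sided curve: the positive part (a choice of orientation) is simple and runs to
infinity, the negative part closes up at time `T` to a Jordan curve rooted at `0` and rests
there afterwards, the two parts meet at `0` only, and the interior of the Jordan curve is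
an open connected bounded set of positive area which is never swallowed and
is a complementary component of the left hull at all times from `T` on. -/
structure IsExoticCurve (lam : ℝ → ℂ) (γ : ℝ → ℂ) (T : ℝ) : Prop where
  creates : CreatesTwoSidedCurve lam γ
  pos_injOn : InjOn γ (Ici 0)
  tendsto_pos : Tendsto γ atTop (Bornology.cobounded ℂ)
  jordan : IsJordanCurveOn γ (-T) 0 0
  stops : ∀ s : ℝ, s ≤ -T → γ s = 0
  inter : γ '' Ici 0 ∩ γ '' Iic 0 = {0}
  interior_open : IsOpen (interiorOf (γ '' Icc (-T) 0))
  interior_connected : IsConnected (interiorOf (γ '' Icc (-T) 0))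
  interior_bounded : Bornology.IsBounded (interiorOf (γ '' Icc (-T) 0))
  interior_area : 0 < volume (interiorOf (γ '' Icc (-T) 0))
  interior_disjoint : ∀ t : ℝ, 0 ≤ t → Disjoint (interiorOf (γ '' Icc (-T) 0)) (leftHull lam t)
  interior_component : ∀ t : ℝ, T ≤ t → ∀ z ∈ interiorOf (γ '' Icc (-T) 0),
    connectedComponentIn (leftHull lam t)ᶜ z = interiorOf (γ '' Icc (-T) 0)

end

/-!
The points that blow up at time `T` under the driver `c t` are the endpoints at time `T` of the
trajectories of the time-reversed flow `y' = c - 2 / y` that issue from `0`. Such a trajectory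
leaves `0` like `± 2 i √s`, and any two that leave on the same side of the real axis coincide; so
there are at most two, and together they trace the curve.

For `c ≠ 0`, the coordinate `ζ = log (1 - c y / 2)` linearises the flow:
`1 + ζ - exp ζ = (c² / 2) s`.
Hence the two trajectories are the two lifts, through the critical point `ζ = 0`, of the ray from
`0` through `c²`, and `y = (2 / c) (1 - exp ζ)`. If `Re c² > 0`, both lifts run off to infinity
with `y`. If `Re c² < 0`, one of them has `Re ζ → -∞` while `Im ζ` grows linearly unless `c² < 0`,
so that `y` spirals into `2 / c`. If `Re c² = 0`, the ray runs into one of the critical values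
`± 2 π i`, at `s = 4 π / |c|²`; there the lift reaches the critical point `ζ = ± 2 π i`, at which
`y = 0` again, so that a loop closes up.
-/

open scoped Real ComplexConjugate

section Gronwall

variable {E : Type*} [NormedAddCommGroup E] [NormedSpace ℝ E] {I : Set ℝ} {f f' : ℝ → E}
  {K : ℝ → ℝ} {a t : ℝ}

theorem eq_zero_of_norm_deriv_le_of_le (hI : I.OrdConnected) (hK : ContinuousOn K I)
    (hf : ∀ s ∈ I, HasDerivWithinAt f (f' s) I s) (hbound : ∀ s ∈ I, ‖f' s‖ ≤ K s * ‖f s‖)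
    (ha : a ∈ I) (ht : t ∈ I) (hat : a ≤ t) (hfa : f a = 0) : f t = 0 := by
  have hsub : Icc a t ⊆ I := hI.out ha ht
  obtain ⟨M, hM⟩ := isCompact_Icc.bddAbove_image (hK.mono hsub)
  refine eq_zero_of_abs_deriv_le_mul_abs_self_of_eq_zero_right (f' := f') (K := M)
    (fun s hs => (hf s (hsub hs)).continuousWithinAt.mono hsub) (fun s hs => ?_) hfa
    (fun s hs => ?_) t (right_mem_Icc.2 hat)
  · exact (hf s (hsub (Ico_subset_Icc_self hs))).mono_of_mem_nhdsWithin <|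
      mem_of_superset (Icc_mem_nhdsGE hs.2) ((Icc_subset_Icc_left hs.1).trans hsub)
  · have hsI := Ico_subset_Icc_self hs
    exact (hbound s (hsub hsI)).trans <| by gcongr; exact hM ⟨s, hsI, rfl⟩

theorem eqOn_zero_of_norm_deriv_le (hI : I.OrdConnected) (hK : ContinuousOn K I)
    (hf : ∀ s ∈ I, HasDerivWithinAt f (f' s) I s) (hbound : ∀ s ∈ I, ‖f' s‖ ≤ K s * ‖f s‖)
    (ha : a ∈ I) (hfa : f a = 0) : EqOn f 0 I := by
  intro t ht
  rcases le_total a t with hat | hta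
  · exact eq_zero_of_norm_deriv_le_of_le hI hK hf hbound ha ht hat hfa
  · have hmaps : MapsTo Neg.neg (Neg.neg ⁻¹' I) I := mapsTo_preimage _ _
    have hrev := eq_zero_of_norm_deriv_le_of_le (f := f ∘ Neg.neg) (f' := fun s => -f' (-s))
      (K := fun s => K (-s)) (a := -a) (t := -t) (hI.preimage_anti fun _ _ => neg_le_neg)
      (hK.comp continuousOn_neg hmaps)
      (fun s hs => by
        simpa using (hf (-s) hs).scomp s (hasDerivWithinAt_neg s _) hmaps)
      (fun s hs => by simpa using hbound (-s) hs)
      (by simpa using ha) (by simpa using ht) (neg_le_neg hta) (by simpa using hfa)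
    simpa using hrev

end Gronwall

section BlowUp

variable {lam : ℝ → ℂ} {z : ℂ} {S T t : ℝ} {g g₁ g₂ : ℝ → ℂ}

theorem IsLoewnerSolution.mono (h : IsLoewnerSolution lam z T g) (hST : S ≤ T) :
    IsLoewnerSolution lam z S g where
  initial := h.initial
  ne_driver t ht := h.ne_driver t (Ico_subset_Ico_right hST ht)
  hasDeriv t ht := (h.hasDeriv t (Ico_subset_Ico_right hST ht)).mono (Ico_subset_Ico_right hST)

theorem IsLoewnerSolution.continuousOn (h : IsLoewnerSolution lam z T g) :
    ContinuousOn g (Ico 0 T) := fun t ht => (h.hasDeriv t ht).continuousWithinAt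

theorem IsLoewnerSolution.eqOn (hlam : ContinuousOn lam (Ici 0))
    (h₁ : IsLoewnerSolution lam z T g₁) (h₂ : IsLoewnerSolution lam z T g₂) :
    EqOn g₁ g₂ (Ico 0 T) := by
  rcases le_or_gt T 0 with hT | hT
  · simp [Ico_eq_empty hT.not_gt]
  have hlam' : ContinuousOn lam (Ico 0 T) := hlam.mono Ico_subset_Ici_self
  set k : ℝ → ℂ := fun t => -2 / ((g₁ t - lam t) * (g₂ t - lam t))
  have hne₁ (t) (ht : t ∈ Ico 0 T) := sub_ne_zero.2 (h₁.ne_driver t ht)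
  have hne₂ (t) (ht : t ∈ Ico 0 T) := sub_ne_zero.2 (h₂.ne_driver t ht)
  have hk : ContinuousOn k (Ico 0 T) :=
    continuousOn_const.div ((h₁.continuousOn.sub hlam').mul (h₂.continuousOn.sub hlam'))
      fun t ht => mul_ne_zero (hne₁ t ht) (hne₂ t ht)
  have hderiv : ∀ t ∈ Ico 0 T,
      HasDerivWithinAt (g₁ - g₂) (k t * (g₁ - g₂) t) (Ico 0 T) t := fun t ht => by
    refine ((h₁.hasDeriv t ht).sub (h₂.hasDeriv t ht)).congr_deriv ?_
    simp only [k, Pi.sub_apply]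
    rw [div_sub_div _ _ (hne₁ t ht) (hne₂ t ht)]
    ring
  have hzero := eqOn_zero_of_norm_deriv_le ordConnected_Ico hk.norm hderiv
    (fun t _ => (norm_mul _ _).le) (left_mem_Ico.2 hT)
    (by simp [h₁.initial, h₂.initial])
  exact fun t ht => sub_eq_zero.1 (hzero ht)

namespace BlowsUpAt

theorem nonneg (h : BlowsUpAt lam z T) : 0 ≤ T := by
  rcases h with ⟨h, -⟩ | ⟨h, -⟩
  exacts [h.ge, h.le]

theorem not_lt (hlam : ContinuousOn lam (Ici 0)) (hS : BlowsUpAt lam z S)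
    (hT : BlowsUpAt lam z T) : ¬ S < T := by
  intro hST
  obtain ⟨rfl, -⟩ | ⟨hT0, g₂, hg₂, -⟩ := hT
  · exact hS.nonneg.not_gt hST
  obtain ⟨rfl, hz⟩ | ⟨hS0, g₁, hg₁, hlim⟩ := hS
  · exact hg₂.ne_driver 0 (left_mem_Ico.2 hT0) (hg₂.initial.trans hz)
  have hagree : EqOn g₁ g₂ (Ico 0 S) := hg₁.eqOn hlam (hg₂.mono hST.le)
  have hcont : Tendsto (fun s => g₂ s - lam s) (𝓝[<] S) (𝓝 (g₂ S - lam S)) := by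
    refine ContinuousAt.tendsto (ContinuousAt.sub ?_ ?_) |>.mono_left nhdsWithin_le_nhds
    · exact hg₂.continuousOn.continuousAt (Ico_mem_nhds hS0 hST)
    · exact hlam.continuousAt (Ici_mem_nhds hS0)
  have heq : (fun s => g₁ s - lam s) =ᶠ[𝓝[<] S] fun s => g₂ s - lam s :=
    eventually_of_mem (Ico_mem_nhdsLT hS0) fun s hs => by simp only [hagree hs]
  exact hg₂.ne_driver S ⟨hS0.le, hST⟩
    (sub_eq_zero.1 (tendsto_nhds_unique (hcont.congr' heq.symm) hlim))

theorem time_unique (hlam : ContinuousOn lam (Ici 0)) (hS : BlowsUpAt lam z S)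
    (hT : BlowsUpAt lam z T) : S = T :=
  le_antisymm (le_of_not_gt (hT.not_lt hlam hS)) (le_of_not_gt (hS.not_lt hlam hT))

theorem blowUpTime_eq (hlam : ContinuousOn lam (Ici 0)) (h : BlowsUpAt lam z T) :
    blowUpTime lam z = T := by
  have htimes : {τ : EReal | ∃ T : ℝ, τ = (T : EReal) ∧ BlowsUpAt lam z T} = {(T : EReal)} := by
    ext τ
    exact ⟨fun ⟨S, hτ, hS⟩ => by rw [hτ, hS.time_unique hlam h, mem_singleton_iff],
      fun hτ => ⟨T, hτ, h⟩⟩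
  rw [blowUpTime, htimes, sInf_singleton]

end BlowsUpAt

theorem blowsUpAt_zero_iff : BlowsUpAt lam z 0 ↔ z = lam 0 := by simp [BlowsUpAt]

theorem blowUpTime_eq_top (h : ∀ T, ¬ BlowsUpAt lam z T) : blowUpTime lam z = ⊤ := by
  simp [blowUpTime, h]

theorem mem_leftHull_iff (hlam : ContinuousOn lam (Ici 0)) :
    z ∈ leftHull lam t ↔ ∃ T ≤ t, BlowsUpAt lam z T := by
  by_cases hex : ∃ T, BlowsUpAt lam z T
  · obtain ⟨T, hT⟩ := hex
    have hmem : z ∈ leftHull lam t ↔ T ≤ t := by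
      rw [leftHull, mem_ofPred_eq, hT.blowUpTime_eq hlam, EReal.coe_le_coe_iff]
    rw [hmem]
    exact ⟨fun h => ⟨T, h, hT⟩, fun ⟨S, hSt, hS⟩ => hT.time_unique hlam hS ▸ hSt⟩
  · push Not at hex
    simp [leftHull, blowUpTime_eq_top hex, hex]

end BlowUp

namespace CreatesTwoSidedCurve

variable {lam γ : ℝ → ℂ} {z : ℂ} {s T : ℝ}

theorem mem_leftHull_abs (h : CreatesTwoSidedCurve lam γ) (s : ℝ) : γ s ∈ leftHull lam |s| := by
  rw [h.hull _ (abs_nonneg s)]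
  exact mem_image_of_mem γ ⟨neg_abs_le s, le_abs_self s⟩

theorem eq_or_eq_of_blowsUpAt (h : CreatesTwoSidedCurve lam γ)
    (hlam : ContinuousOn lam (Ici 0)) (hz : BlowsUpAt lam z T) : z = γ T ∨ z = γ (-T) := by
  have hhull : z ∈ leftHull lam T := (mem_leftHull_iff hlam).2 ⟨T, le_rfl, hz⟩
  rw [h.hull T hz.nonneg] at hhull
  obtain ⟨s, hs, rfl⟩ := hhull
  obtain ⟨S, hS, hzS⟩ := (mem_leftHull_iff hlam).1 (h.mem_leftHull_abs s)
  have hT : |s| = T := le_antisymm (abs_le.2 hs) (hz.time_unique hlam hzS ▸ hS)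
  rcases eq_or_eq_neg_of_abs_eq hT with rfl | rfl <;> simp

theorem blowsUpAt_abs (h : CreatesTwoSidedCurve lam γ) (hlam : ContinuousOn lam (Ici 0))
    (hs : ∀ r, |r| < |s| → γ r ≠ γ s) : BlowsUpAt lam (γ s) |s| := by
  obtain ⟨S, hS, hbS⟩ := (mem_leftHull_iff hlam).1 (h.mem_leftHull_abs s)
  have hhull : γ s ∈ leftHull lam S := (mem_leftHull_iff hlam).2 ⟨S, le_rfl, hbS⟩
  rw [h.hull S hbS.nonneg] at hhull
  obtain ⟨r, hr, hrs⟩ := hhull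
  have hle : |s| ≤ S := le_of_not_gt fun hlt => hs r ((abs_le.2 hr).trans_lt hlt) hrs
  rwa [le_antisymm hle hS]

theorem blowsUpAt_abs_of_injective (h : CreatesTwoSidedCurve lam γ)
    (hlam : ContinuousOn lam (Ici 0)) (hinj : Function.Injective γ) (s : ℝ) :
    BlowsUpAt lam (γ s) |s| :=
  h.blowsUpAt_abs hlam fun _ hr hrs => hr.ne (congrArg abs (hinj hrs))

end CreatesTwoSidedCurve

namespace IsExoticCurve

variable {lam γ : ℝ → ℂ} {r s t T : ℝ} {z : ℂ}

theorem time_pos (h : IsExoticCurve lam γ T) : 0 < T := neg_lt_zero.1 h.jordan.lt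

theorem driver_zero (h : IsExoticCurve lam γ T) : lam 0 = 0 :=
  h.creates.start.symm.trans h.jordan.right

theorem eq_zero_of_apply_eq (h : IsExoticCurve lam γ T) (hr : 0 ≤ r) (hs : s ≤ 0)
    (hrs : γ r = γ s) : γ r = 0 := by
  have hmem : γ r ∈ γ '' Ici 0 ∩ γ '' Iic 0 := ⟨⟨r, hr, rfl⟩, ⟨s, hs, hrs.symm⟩⟩
  rwa [h.inter] at hmem

theorem apply_ne_zero_of_pos (h : IsExoticCurve lam γ T) (ht : 0 < t) : γ t ≠ 0 := fun h0 =>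
  ht.ne' (h.pos_injOn ht.le self_mem_Ici (h0.trans h.jordan.right.symm))

theorem apply_ne_zero_of_neg (h : IsExoticCurve lam γ T) (ht : t ∈ Ioo (-T) 0) : γ t ≠ 0 :=
  fun h0 => ht.2.ne <| h.jordan.injOn ⟨ht.1, ht.2.le⟩ (right_mem_Ioc.2 h.jordan.lt)
    (h0.trans h.jordan.right.symm)

theorem eq_of_blowsUpAt (h : IsExoticCurve lam γ T) (hlam : ContinuousOn lam (Ici 0))
    (ht : T ≤ t) (hz : BlowsUpAt lam z t) : z = γ t := by
  refine (h.creates.eq_or_eq_of_blowsUpAt hlam hz).resolve_right fun hz0 => ?_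
  rw [h.stops _ (neg_le_neg ht), ← h.driver_zero] at hz0
  have := hz.time_unique hlam (blowsUpAt_zero_iff.2 hz0)
  linarith [h.time_pos]

theorem blowsUpAt_of_pos (h : IsExoticCurve lam γ T) (hlam : ContinuousOn lam (Ici 0))
    (ht : 0 < t) : BlowsUpAt lam (γ t) t := by
  have hb := h.creates.blowsUpAt_abs hlam (s := t) fun r hr hrt => by
    rw [abs_of_pos ht] at hr
    rcases le_total 0 r with h0r | hr0
    · exact ((le_abs_self r).trans_lt hr).ne (h.pos_injOn h0r ht.le hrt)
    · exact h.apply_ne_zero_of_pos ht (h.eq_zero_of_apply_eq ht.le hr0 hrt.symm)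
  rwa [abs_of_pos ht] at hb

theorem blowsUpAt_of_neg (h : IsExoticCurve lam γ T) (hlam : ContinuousOn lam (Ici 0))
    (ht : 0 < t) (htT : t < T) : BlowsUpAt lam (γ (-t)) t := by
  have hb := h.creates.blowsUpAt_abs hlam (s := -t) fun r hr hrt => by
    rw [abs_neg, abs_of_pos ht] at hr
    have hlt : -t < r := (abs_lt.1 hr).1
    rcases le_total 0 r with h0r | hr0
    · exact h.apply_ne_zero_of_neg ⟨neg_lt_neg htT, neg_lt_zero.2 ht⟩
        (hrt ▸ h.eq_zero_of_apply_eq h0r (neg_lt_zero.2 ht).le hrt)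
    · exact hlt.ne' (h.jordan.injOn ⟨(neg_lt_neg htT).trans hlt, hr0⟩
        ⟨neg_lt_neg htT, (neg_lt_zero.2 ht).le⟩ hrt)
  rwa [abs_neg, abs_of_pos ht] at hb

theorem apply_ne_apply_neg (h : IsExoticCurve lam γ T) (ht : 0 < t) : γ t ≠ γ (-t) := fun heq =>
  h.apply_ne_zero_of_pos ht (h.eq_zero_of_apply_eq ht.le (neg_lt_zero.2 ht).le heq)

end IsExoticCurve

theorem eqOn_or_eqOn_of_isPreconnected {X Y : Type*} [TopologicalSpace X] [TopologicalSpace Y]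
    [T2Space Y] {s : Set X} (hs : IsPreconnected s) {f g h : X → Y} (hf : ContinuousOn f s)
    (hg : ContinuousOn g s) (hh : ContinuousOn h s) (hfgh : ∀ x ∈ s, f x = g x ∨ f x = h x)
    (hgh : ∀ x ∈ s, g x ≠ h x) : EqOn f g s ∨ EqOn f h s := by
  have : PreconnectedSpace s := isPreconnected_iff_preconnectedSpace.1 hs
  rw [continuousOn_iff_continuous_domRestrict] at hf hg hh
  have hcompl : {x : s | f x = g x}ᶜ = {x : s | f x = h x} := by
    ext x
    exact ⟨(hfgh x x.2).resolve_left, fun hx hx' => hgh x x.2 (hx'.symm.trans hx)⟩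
  have hclopen : IsClopen {x : s | f x = g x} :=
    ⟨isClosed_eq hf hg, isClosed_compl_iff.1 (hcompl ▸ isClosed_eq hf hh)⟩
  rcases isClopen_iff.1 hclopen with hempty | huniv
  · rw [hempty, compl_empty] at hcompl
    exact Or.inr fun x hx => hcompl.subset (mem_univ ⟨x, hx⟩)
  · exact Or.inl fun x hx => huniv.symm.subset (mem_univ ⟨x, hx⟩)

/-- The two-sided curve with halves `γp` and `γm`, both parametrized by `[0, ∞)`; at `0` it takes
the value of `γp`. -/
noncomputable def twoSided (γp γm : ℝ → ℂ) (t : ℝ) : ℂ := if 0 ≤ t then γp t else γm (-t)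

section twoSided

variable {γp γm : ℝ → ℂ} {t : ℝ}

theorem twoSided_of_nonneg (ht : 0 ≤ t) : twoSided γp γm t = γp t := if_pos ht

theorem twoSided_neg_of_pos (ht : 0 < t) : twoSided γp γm (-t) = γm t := by simp [twoSided, ht]

theorem twoSided_neg (h0 : γp 0 = γm 0) (ht : 0 ≤ t) : twoSided γp γm (-t) = γm t := by
  rcases ht.eq_or_lt with rfl | ht
  · simpa [twoSided] using h0
  · exact twoSided_neg_of_pos ht

theorem continuous_twoSided (h0 : γp 0 = γm 0) (hp : ContinuousOn γp (Ici 0))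
    (hm : ContinuousOn γm (Ici 0)) : Continuous (twoSided γp γm) := by
  have hright : ContinuousOn (twoSided γp γm) (Ici 0) :=
    hp.congr fun t ht => twoSided_of_nonneg ht
  have hleft : ContinuousOn (twoSided γp γm) (Iic 0) :=
    (hm.comp continuousOn_neg fun t ht => neg_nonneg.2 (mem_Iic.1 ht)).congr fun t ht => by
      simpa using twoSided_neg h0 (neg_nonneg.2 (mem_Iic.1 ht))
  rw [← continuousOn_univ, ← Iic_union_Ici (a := (0 : ℝ))]
  exact hleft.union_of_isClosed hright isClosed_Iic isClosed_Ici

end twoSided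

/-- The driver `lam` swallows exactly one or two points at each time `T > 0`: the point `γp T`
and, as long as `T` precedes the lifetime `S` of the second branch, a further point `γm T`. After
a finite lifetime the second branch rests at the starting point. -/
structure IsBlowUpPair (lam γp γm : ℝ → ℂ) (S : EReal) : Prop where
  pos_zero : γp 0 = lam 0
  neg_zero : γm 0 = lam 0
  pos_continuousOn : ContinuousOn γp (Ici 0)
  neg_continuousOn : ContinuousOn γm (Ici 0)
  ne : ∀ T : ℝ, 0 < T → T < S → γp T ≠ γm T
  rests : ∀ T : ℝ, S ≤ T → γm T = lam 0
  blowsUpAt_iff : ∀ T : ℝ, 0 < T → ∀ z, BlowsUpAt lam z T ↔ z = γp T ∨ z = γm T ∧ T < S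

namespace IsBlowUpPair

variable {lam γp γm γ : ℝ → ℂ} {S : EReal} {s t T : ℝ} {z : ℂ}

theorem pos_zero_eq_neg_zero (h : IsBlowUpPair lam γp γm S) : γp 0 = γm 0 :=
  h.pos_zero.trans h.neg_zero.symm

theorem blowsUpAt_pos (h : IsBlowUpPair lam γp γm S) (ht : 0 ≤ t) : BlowsUpAt lam (γp t) t := by
  rcases ht.eq_or_lt with rfl | ht
  · exact blowsUpAt_zero_iff.2 h.pos_zero
  · exact (h.blowsUpAt_iff t ht _).2 (Or.inl rfl)

theorem blowsUpAt_neg (h : IsBlowUpPair lam γp γm S) (ht : 0 ≤ t) (htS : t < S) :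
    BlowsUpAt lam (γm t) t := by
  rcases ht.eq_or_lt with rfl | ht
  · exact blowsUpAt_zero_iff.2 h.neg_zero
  · exact (h.blowsUpAt_iff t ht _).2 (Or.inr ⟨rfl, htS⟩)

theorem eq_or_eq_of_blowsUpAt (h : IsBlowUpPair lam γp γm S) (hz : BlowsUpAt lam z t) :
    z = γp t ∨ z = γm t := by
  rcases hz.nonneg.eq_or_lt with rfl | ht
  · exact Or.inl ((blowsUpAt_zero_iff.1 hz).trans h.pos_zero.symm)
  · exact ((h.blowsUpAt_iff t ht z).1 hz).imp_right And.left

theorem eq_of_blowsUpAt (h : IsBlowUpPair lam γp γm S) (ht : 0 < t) (hSt : S ≤ t)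
    (hz : BlowsUpAt lam z t) : z = γp t :=
  ((h.blowsUpAt_iff t ht z).1 hz).resolve_right fun hz' => hSt.not_gt hz'.2

theorem pos_injOn (h : IsBlowUpPair lam γp γm S) (hlam : ContinuousOn lam (Ici 0)) :
    InjOn γp (Ici 0) := fun _ hs _ ht hst =>
  (h.blowsUpAt_pos hs).time_unique hlam (hst ▸ h.blowsUpAt_pos ht)

theorem neg_injOn (h : IsBlowUpPair lam γp γm S) (hlam : ContinuousOn lam (Ici 0)) :
    InjOn γm {t : ℝ | 0 ≤ t ∧ t < S} := fun _ hs _ ht hst =>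
  (h.blowsUpAt_neg hs.1 hs.2).time_unique hlam (hst ▸ h.blowsUpAt_neg ht.1 ht.2)

theorem eq_zero_of_pos_eq_neg (h : IsBlowUpPair lam γp γm S) (hlam : ContinuousOn lam (Ici 0))
    (hs : 0 ≤ s) (ht : 0 ≤ t) (hst : γp s = γm t) : s = 0 := by
  by_contra hs0
  rcases lt_or_ge (t : EReal) S with htS | htS
  · obtain rfl : s = t :=
      (h.blowsUpAt_pos hs).time_unique hlam (hst ▸ h.blowsUpAt_neg ht htS)
    exact h.ne s (hs.lt_of_ne' hs0) htS hst
  · have hstart : γp s = γp 0 := by rw [hst, h.rests t htS, h.pos_zero]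
    exact hs0 (h.pos_injOn hlam hs self_mem_Ici hstart)

theorem creates (h : IsBlowUpPair lam γp γm S) (hlam : ContinuousOn lam (Ici 0)) :
    CreatesTwoSidedCurve lam (twoSided γp γm) where
  continuous := continuous_twoSided h.pos_zero_eq_neg_zero h.pos_continuousOn h.neg_continuousOn
  start := (twoSided_of_nonneg le_rfl).trans h.pos_zero
  hull t ht := by
    ext z
    rw [mem_leftHull_iff hlam]
    constructor
    · rintro ⟨T, hTt, hz⟩
      have hT := hz.nonneg
      rcases h.eq_or_eq_of_blowsUpAt hz with rfl | rfl
      · exact ⟨T, ⟨by linarith, hTt⟩, twoSided_of_nonneg hT⟩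
      · exact ⟨-T, ⟨by linarith, by linarith⟩, twoSided_neg h.pos_zero_eq_neg_zero hT⟩
    · rintro ⟨s, hs, rfl⟩
      rcases le_or_gt 0 s with hs0 | hs0
      · rw [twoSided_of_nonneg hs0]
        exact ⟨s, hs.2, h.blowsUpAt_pos hs0⟩
      · obtain ⟨r, rfl⟩ : ∃ r, s = -r := ⟨-s, (neg_neg s).symm⟩
        rw [twoSided_neg_of_pos (neg_lt_zero.1 hs0)]
        rcases lt_or_ge (r : EReal) S with hrS | hrS
        · exact ⟨r, neg_le_neg_iff.1 hs.1, h.blowsUpAt_neg (neg_lt_zero.1 hs0).le hrS⟩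
        · exact ⟨0, ht, blowsUpAt_zero_iff.2 (h.rests r hrS)⟩

theorem injective (h : IsBlowUpPair lam γp γm ⊤) (hlam : ContinuousOn lam (Ici 0)) :
    Function.Injective (twoSided γp γm) := by
  intro s t hst
  wlog hle : s ≤ t generalizing s t
  · exact (this hst.symm (le_of_not_ge hle)).symm
  rcases le_or_gt 0 s with hs | hs
  · have ht : 0 ≤ t := hs.trans hle
    rw [twoSided_of_nonneg hs, twoSided_of_nonneg ht] at hst
    exact h.pos_injOn hlam hs ht hst
  obtain ⟨r, rfl⟩ : ∃ r, s = -r := ⟨-s, (neg_neg s).symm⟩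
  have hr : 0 < r := neg_lt_zero.1 hs
  rw [twoSided_neg_of_pos hr] at hst
  rcases le_or_gt 0 t with ht | ht
  · rw [twoSided_of_nonneg ht] at hst
    obtain rfl := h.eq_zero_of_pos_eq_neg hlam ht hr.le hst.symm
    rw [h.pos_zero_eq_neg_zero] at hst
    obtain rfl := h.neg_injOn hlam ⟨hr.le, EReal.coe_lt_top r⟩ ⟨le_rfl, EReal.coe_lt_top 0⟩ hst
    exact _root_.neg_zero
  · obtain ⟨q, rfl⟩ : ∃ q, t = -q := ⟨-t, (neg_neg t).symm⟩
    have hq : 0 < q := neg_lt_zero.1 ht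
    rw [twoSided_neg_of_pos hq] at hst
    rw [h.neg_injOn hlam ⟨hr.le, EReal.coe_lt_top r⟩ ⟨hq.le, EReal.coe_lt_top q⟩ hst]

theorem eq_twoSided_or_eq_twoSided (h : IsBlowUpPair lam γp γm ⊤)
    (hlam : ContinuousOn lam (Ici 0)) (hγ : CreatesTwoSidedCurve lam γ)
    (hinj : Function.Injective γ) : γ = twoSided γp γm ∨ γ = twoSided γm γp := by
  have hpos (t) (ht : 0 < t) : γ t = γp t ∨ γ t = γm t := h.eq_or_eq_of_blowsUpAt <| by
    simpa only [abs_of_pos ht] using hγ.blowsUpAt_abs_of_injective hlam hinj t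
  have hneg (t) (ht : 0 < t) : γ (-t) = γp t ∨ γ (-t) = γm t := h.eq_or_eq_of_blowsUpAt <| by
    simpa only [abs_neg, abs_of_pos ht] using hγ.blowsUpAt_abs_of_injective hlam hinj (-t)
  have hne (t) (ht : 0 < t) : γ t ≠ γ (-t) := fun heq => by linarith [hinj heq]
  have extend (γ₁ γ₂ : ℝ → ℂ) (h0 : γ₁ 0 = lam 0) (h₁ : EqOn γ γ₁ (Ioi 0))
      (h₂ : ∀ t, 0 < t → γ (-t) = γ₂ t) : γ = twoSided γ₁ γ₂ := by
    funext t
    rcases lt_trichotomy t 0 with ht | rfl | ht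
    · rw [← neg_neg t, h₂ _ (neg_pos.2 ht), twoSided_neg_of_pos (neg_pos.2 ht)]
    · rw [hγ.start, twoSided_of_nonneg le_rfl, h0]
    · rw [h₁ ht, twoSided_of_nonneg ht.le]
  rcases eqOn_or_eqOn_of_isPreconnected isPreconnected_Ioi hγ.continuous.continuousOn
    (h.pos_continuousOn.mono Ioi_subset_Ici_self) (h.neg_continuousOn.mono Ioi_subset_Ici_self)
    hpos (fun t ht => h.ne t ht (EReal.coe_lt_top t)) with heq | heq
  · exact Or.inl <| extend γp γm h.pos_zero heq fun t ht =>
      (hneg t ht).resolve_left fun h' => hne t ht ((heq ht).trans h'.symm)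
  · exact Or.inr <| extend γm γp h.neg_zero heq fun t ht =>
      (hneg t ht).resolve_right fun h' => hne t ht ((heq ht).trans h'.symm)

theorem lifetime_eq_top_of_injective (h : IsBlowUpPair lam γp γm S)
    (hlam : ContinuousOn lam (Ici 0)) (hγ : CreatesTwoSidedCurve lam γ)
    (hinj : Function.Injective γ) : S = ⊤ := by
  by_contra hS
  obtain ⟨t, ht⟩ := EReal.lt_iff_exists_real_btwn.1 (max_lt (lt_top_iff_ne_top.2 hS)
    (EReal.coe_lt_top 0))
  have hSt : S ≤ t := (le_max_left _ _).trans ht.1.le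
  have ht0 : 0 < t := EReal.coe_lt_coe_iff.1 ((le_max_right _ _).trans_lt ht.1)
  have hpos := hγ.blowsUpAt_abs_of_injective hlam hinj t
  have hneg := hγ.blowsUpAt_abs_of_injective hlam hinj (-t)
  rw [abs_neg] at hneg
  rw [abs_of_pos ht0] at hpos hneg
  have := hinj ((h.eq_of_blowsUpAt ht0 hSt hpos).trans (h.eq_of_blowsUpAt ht0 hSt hneg).symm)
  linarith

theorem lifetime_eq_of_isExoticCurve (h : IsBlowUpPair lam γp γm S)
    (hlam : ContinuousOn lam (Ici 0)) (hγ : IsExoticCurve lam γ T) : S = T := by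
  rcases lt_trichotomy S T with hST | hST | hTS
  · exfalso
    obtain ⟨t, ht, htT⟩ := EReal.lt_iff_exists_real_btwn.1
      (max_lt hST (EReal.coe_lt_coe_iff.2 hγ.time_pos))
    have hSt : S ≤ t := (le_max_left _ _).trans ht.le
    have ht0 : 0 < t := EReal.coe_lt_coe_iff.1 ((le_max_right _ _).trans_lt ht)
    have hpos := h.eq_of_blowsUpAt ht0 hSt (hγ.blowsUpAt_of_pos hlam ht0)
    have hneg := h.eq_of_blowsUpAt ht0 hSt
      (hγ.blowsUpAt_of_neg hlam ht0 (EReal.coe_lt_coe_iff.1 htT))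
    exact hγ.apply_ne_apply_neg ht0 (hpos.trans hneg.symm)
  · exact hST
  · have hpos := hγ.eq_of_blowsUpAt hlam le_rfl (h.blowsUpAt_pos hγ.time_pos.le)
    have hneg := hγ.eq_of_blowsUpAt hlam le_rfl (h.blowsUpAt_neg hγ.time_pos.le hTS)
    exact absurd (hpos.trans hneg.symm) (h.ne T hγ.time_pos hTS)

end IsBlowUpPair

section Monotone

variable {f : ℝ → ℝ} {a b l t : ℝ}

theorem le_of_antitoneOn_of_tendsto (hf : AntitoneOn f (Ioc a b))
    (hlim : Tendsto f (𝓝[>] a) (𝓝 l)) (ht : t ∈ Ioc a b) : f t ≤ l :=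
  ge_of_tendsto hlim <| eventually_of_mem (Ioo_mem_nhdsGT ht.1) fun _ hs =>
    hf ⟨hs.1, hs.2.le.trans ht.2⟩ ht hs.2.le

theorem lt_of_strictAntiOn_of_tendsto (hf : StrictAntiOn f (Ioc a b))
    (hlim : Tendsto f (𝓝[>] a) (𝓝 l)) (ht : t ∈ Ioc a b) : f t < l := by
  obtain ⟨r, har, hrt⟩ := exists_between ht.1
  have hr : r ∈ Ioc a b := ⟨har, hrt.le.trans ht.2⟩
  exact (hf hr ht hrt).trans_le (le_of_antitoneOn_of_tendsto hf.antitoneOn hlim hr)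

end Monotone

/-- A trajectory on `(0, T]` of `y' = c - 2 / y` which emanates from the singularity `0`. This is
the equation of the centred flow `g t - c t` of the driver `t ↦ c t` with time reversed. -/
structure IsReverseTrajectory (c : ℂ) (T : ℝ) (y : ℝ → ℂ) : Prop where
  tendsto_zero : Tendsto y (𝓝[>] 0) (𝓝 0)
  ne_zero : ∀ s ∈ Ioc 0 T, y s ≠ 0
  hasDeriv : ∀ s ∈ Ioc 0 T, HasDerivWithinAt y (c - 2 / y s) (Ioc 0 T) s

namespace IsReverseTrajectory

variable {c : ℂ} {S T a s : ℝ} {y y₁ y₂ y₃ : ℝ → ℂ}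

theorem mono (h : IsReverseTrajectory c T y) (hST : S ≤ T) : IsReverseTrajectory c S y where
  tendsto_zero := h.tendsto_zero
  ne_zero s hs := h.ne_zero s (Ioc_subset_Ioc_right hST hs)
  hasDeriv s hs := (h.hasDeriv s (Ioc_subset_Ioc_right hST hs)).mono (Ioc_subset_Ioc_right hST)

theorem congr (h : IsReverseTrajectory c T y₁) (hS : 0 < S) (hTS : T < S)
    (heq : EqOn y₂ y₁ (Ioo 0 S)) : IsReverseTrajectory c T y₂ where
  tendsto_zero :=
    h.tendsto_zero.congr' (eventually_of_mem (Ioo_mem_nhdsGT hS) fun _ hs => (heq hs).symm)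
  ne_zero s hs := heq ⟨hs.1, hs.2.trans_lt hTS⟩ ▸ h.ne_zero s hs
  hasDeriv s hs := by
    have heq' : EqOn y₂ y₁ (Ioc 0 T) := heq.mono (Ioc_subset_Ioo_right hTS)
    rw [heq' hs]
    exact (h.hasDeriv s hs).congr heq' (heq' hs)

theorem hasDerivAt (h : IsReverseTrajectory c T y) (hs : s ∈ Ioo 0 T) :
    HasDerivAt y (c - 2 / y s) s :=
  (h.hasDeriv s (Ioo_subset_Ioc_self hs)).hasDerivAt (Ioc_mem_nhds hs.1 hs.2)

theorem continuousOn (h : IsReverseTrajectory c T y) : ContinuousOn y (Ioc 0 T) := fun s hs =>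
  (h.hasDeriv s hs).continuousWithinAt

theorem hasDerivWithinAt_sub (h₁ : IsReverseTrajectory c T y₁) (h₂ : IsReverseTrajectory c T y₂)
    (hs : s ∈ Ioc 0 T) :
    HasDerivWithinAt (y₁ - y₂) (2 / (y₁ s * y₂ s) * (y₁ - y₂) s) (Ioc 0 T) s := by
  have hne₁ := h₁.ne_zero s hs
  have hne₂ := h₂.ne_zero s hs
  refine ((h₁.hasDeriv s hs).sub (h₂.hasDeriv s hs)).congr_deriv ?_
  simp only [Pi.sub_apply]
  field_simp
  ring

theorem eqOn_of_eq (h₁ : IsReverseTrajectory c T y₁) (h₂ : IsReverseTrajectory c T y₂)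
    (ha : a ∈ Ioc 0 T) (heq : y₁ a = y₂ a) : EqOn y₁ y₂ (Ioc 0 T) := by
  have hk : ContinuousOn (fun s => 2 / (y₁ s * y₂ s)) (Ioc 0 T) :=
    continuousOn_const.div (h₁.continuousOn.mul h₂.continuousOn)
      fun s hs => mul_ne_zero (h₁.ne_zero s hs) (h₂.ne_zero s hs)
  have hzero := eqOn_zero_of_norm_deriv_le ordConnected_Ioc hk.norm
    (fun s hs => h₁.hasDerivWithinAt_sub h₂ hs) (fun s _ => (norm_mul _ _).le) ha
    (sub_eq_zero.2 heq)
  exact fun s hs => sub_eq_zero.1 (hzero hs)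

theorem hasDerivAt_re_sq (h : IsReverseTrajectory c T y) (hs : s ∈ Ioo 0 T) :
    HasDerivAt (fun s => (y s ^ 2).re) (2 * c * y s - 4).re s := by
  have hne := h.ne_zero s (Ioo_subset_Ioc_self hs)
  refine (Complex.reCLM.hasFDerivAt.comp_hasDerivAt s ((h.hasDerivAt hs).pow 2)).congr_deriv ?_
  rw [Complex.reCLM_apply]
  congr 1
  field_simp
  push_cast
  ring

/-- Since `(y ^ 2)' = 2 * c * y - 4`, the real part of `y ^ 2` decreases from `0` as long as `y` is
small. -/
theorem eventually_abs_re_lt_abs_im (h : IsReverseTrajectory c T y) (hT : 0 < T) :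
    ∀ᶠ s in 𝓝[>] 0, |(y s).re| < |(y s).im| := by
  have hderiv : Tendsto (fun s => (2 * c * y s - 4).re) (𝓝[>] 0) (𝓝 (2 * c * 0 - 4).re) :=
    (Complex.continuous_re.tendsto _).comp ((h.tendsto_zero.const_mul _).sub_const _)
  have hneg : ∀ᶠ s in 𝓝[>] 0, (2 * c * y s - 4).re < 0 ∧ s < T :=
    (hderiv.eventually_lt_const (by simp)).and
      (eventually_of_mem (Ioo_mem_nhdsGT hT) fun _ hs => hs.2)
  obtain ⟨ε, hε, hsub⟩ := (mem_nhdsGT_iff_exists_Ioc_subset).1 hneg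
  have hεT : Ioc 0 ε ⊆ Ioo 0 T := fun s hs => ⟨hs.1, (hsub hs).2⟩
  have hanti : StrictAntiOn (fun s => (y s ^ 2).re) (Ioc 0 ε) := by
    refine strictAntiOn_of_hasDerivWithinAt_neg (convex_Ioc 0 ε)
      (f' := fun s => (2 * c * y s - 4).re)
      (fun s hs => (h.hasDerivAt_re_sq (hεT hs)).continuousAt.continuousWithinAt)
      (fun s hs => (h.hasDerivAt_re_sq (hεT (interior_subset hs))).hasDerivWithinAt)
      (fun s hs => (hsub (interior_subset hs)).1)
  have hlim : Tendsto (fun s => (y s ^ 2).re) (𝓝[>] 0) (𝓝 ((0 : ℂ) ^ 2).re) :=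
    (Complex.continuous_re.tendsto _).comp (h.tendsto_zero.pow 2)
  filter_upwards [Ioc_mem_nhdsGT hε] with s hs
  have hre := lt_of_strictAntiOn_of_tendsto hanti hlim hs
  rw [← sq_lt_sq]
  simp only [sq, Complex.mul_re, mul_zero, Complex.zero_re] at hre ⊢
  linarith

theorem eq_of_re_mul_neg (h₁ : IsReverseTrajectory c T y₁) (h₂ : IsReverseTrajectory c T y₂)
    (hT : 0 < T) (hneg : ∀ s ∈ Ioc 0 T, (y₁ s * y₂ s).re < 0) : y₁ T = y₂ T := by
  have hderiv : ∀ s ∈ Ioc 0 T, HasDerivWithinAt (fun s => ‖(y₁ - y₂) s‖ ^ 2)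
      (2 * inner ℝ ((y₁ - y₂) s) (2 / (y₁ s * y₂ s) * (y₁ - y₂) s)) (Ioc 0 T) s :=
    fun s hs => (h₁.hasDerivWithinAt_sub h₂ hs).norm_sq
  have hnonpos : ∀ s ∈ Ioc 0 T,
      2 * inner ℝ ((y₁ - y₂) s) (2 / (y₁ s * y₂ s) * (y₁ - y₂) s) ≤ 0 := fun s hs => by
    have hinner (P Q : ℂ) : inner ℝ P (Q * P) = Q.re * ‖P‖ ^ 2 := by
      rw [Complex.inner, mul_assoc, Complex.mul_conj', ← Complex.ofReal_pow,
        Complex.re_mul_ofReal]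
    have hre : (2 / (y₁ s * y₂ s)).re ≤ 0 := by
      rw [Complex.div_re]
      simp only [Complex.re_ofNat, Complex.im_ofNat, zero_mul, zero_div, add_zero]
      exact div_nonpos_of_nonpos_of_nonneg (by linarith [hneg s hs]) (Complex.normSq_nonneg _)
    rw [hinner]
    exact mul_nonpos_of_nonneg_of_nonpos zero_le_two
      (mul_nonpos_of_nonpos_of_nonneg hre (sq_nonneg _))
  have hanti : AntitoneOn (fun s => ‖(y₁ - y₂) s‖ ^ 2) (Ioc 0 T) :=
    antitoneOn_of_hasDerivWithinAt_nonpos (convex_Ioc 0 T)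
      (fun s hs => (hderiv s hs).continuousWithinAt)
      (fun s hs => (hderiv s (interior_subset hs)).mono interior_subset)
      (fun s hs => hnonpos s (interior_subset hs))
  have hlim : Tendsto (fun s => ‖(y₁ - y₂) s‖ ^ 2) (𝓝[>] 0) (𝓝 0) := by
    simpa using (h₁.tendsto_zero.sub h₂.tendsto_zero).norm.pow 2
  have hzero := le_of_antitoneOn_of_tendsto hanti hlim (right_mem_Ioc.2 hT)
  exact sub_eq_zero.1 (norm_eq_zero.1 (pow_eq_zero_iff two_ne_zero |>.1
    (le_antisymm hzero (sq_nonneg _))))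

theorem eq_of_im_mul_im_pos (h₁ : IsReverseTrajectory c T y₁) (h₂ : IsReverseTrajectory c T y₂)
    (hT : 0 < T) (hcone₁ : ∀ s ∈ Ioc 0 T, |(y₁ s).re| < |(y₁ s).im|)
    (hcone₂ : ∀ s ∈ Ioc 0 T, |(y₂ s).re| < |(y₂ s).im|)
    (hpos : 0 < (y₁ T).im * (y₂ T).im) : y₁ T = y₂ T := by
  have hcont : ContinuousOn (fun s => (y₁ s).im * (y₂ s).im) (Ioc 0 T) :=
    (Complex.continuous_im.comp_continuousOn h₁.continuousOn).mul
      (Complex.continuous_im.comp_continuousOn h₂.continuousOn)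
  have hprod (s) (hs : s ∈ Ioc 0 T) : |(y₁ s).re * (y₂ s).re| < |(y₁ s).im * (y₂ s).im| := by
    rw [abs_mul, abs_mul]
    exact mul_lt_mul'' (hcone₁ s hs) (hcone₂ s hs) (abs_nonneg _) (abs_nonneg _)
  refine h₁.eq_of_re_mul_neg h₂ hT fun s hs => ?_
  have him : 0 < (y₁ s).im * (y₂ s).im := by
    by_contra! hle
    obtain ⟨r, hr, hr0⟩ := isPreconnected_Ioc.intermediate_value hs (right_mem_Ioc.2 hT) hcont
      ⟨hle, hpos.le⟩
    have hlt := hprod r hr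
    rw [show (y₁ r).im * (y₂ r).im = 0 from hr0, abs_zero] at hlt
    exact (abs_nonneg _).not_gt hlt
  have hlt := (le_abs_self _).trans_lt (hprod s hs)
  rw [abs_of_pos him] at hlt
  rwa [Complex.mul_re, sub_neg]

/-- Near the singularity a trajectory stays in one of the two cones `|re| < |im|`, and two
trajectories in the same cone approach each other. -/
theorem eqOn_or_eqOn_or_eqOn (h₁ : IsReverseTrajectory c T y₁) (h₂ : IsReverseTrajectory c T y₂)
    (h₃ : IsReverseTrajectory c T y₃) (hT : 0 < T) :
    EqOn y₁ y₂ (Ioc 0 T) ∨ EqOn y₁ y₃ (Ioc 0 T) ∨ EqOn y₂ y₃ (Ioc 0 T) := by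
  have hcones : ∀ᶠ s in 𝓝[>] (0 : ℝ), s < T ∧ |(y₁ s).re| < |(y₁ s).im| ∧
      |(y₂ s).re| < |(y₂ s).im| ∧ |(y₃ s).re| < |(y₃ s).im| := by
    filter_upwards [Ioo_mem_nhdsGT hT, h₁.eventually_abs_re_lt_abs_im hT,
      h₂.eventually_abs_re_lt_abs_im hT, h₃.eventually_abs_re_lt_abs_im hT] with s hs hc₁ hc₂ hc₃
    exact ⟨hs.2, hc₁, hc₂, hc₃⟩
  obtain ⟨ε, hε, hsub⟩ := mem_nhdsGT_iff_exists_Ioc_subset.1 hcones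
  have hεε : ε ∈ Ioc 0 ε := right_mem_Ioc.2 hε
  obtain ⟨hεT, hε₁, hε₂, hε₃⟩ := hsub hεε
  have him {w : ℂ} (hw : |w.re| < |w.im|) : w.im ≠ 0 :=
    abs_pos.1 ((abs_nonneg _).trans_lt hw)
  have hsign {a b c : ℝ} (ha : a ≠ 0) (hb : b ≠ 0) (hc : c ≠ 0) :
      0 < a * b ∨ 0 < a * c ∨ 0 < b * c := by
    rcases ha.lt_or_gt with ha | ha <;> rcases hb.lt_or_gt with hb | hb <;>
      rcases hc.lt_or_gt with hc | hc <;> simp [mul_pos_of_neg_of_neg, *]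
  have heqOn {y y' : ℝ → ℂ} (h : IsReverseTrajectory c T y) (h' : IsReverseTrajectory c T y')
      (hc : ∀ s ∈ Ioc 0 ε, |(y s).re| < |(y s).im|)
      (hc' : ∀ s ∈ Ioc 0 ε, |(y' s).re| < |(y' s).im|) (hpos : 0 < (y ε).im * (y' ε).im) :
      EqOn y y' (Ioc 0 T) :=
    h.eqOn_of_eq h' ⟨hε, hεT.le⟩ <|
      (h.mono hεT.le).eq_of_im_mul_im_pos (h'.mono hεT.le) hε hc hc' hpos
  exact (hsign (him hε₁) (him hε₂) (him hε₃)).imp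
    (heqOn h₁ h₂ (fun s hs => (hsub hs).2.1) fun s hs => (hsub hs).2.2.1)
    (Or.imp (heqOn h₁ h₃ (fun s hs => (hsub hs).2.1) fun s hs => (hsub hs).2.2.2)
      (heqOn h₂ h₃ (fun s hs => (hsub hs).2.2.1) fun s hs => (hsub hs).2.2.2))

end IsReverseTrajectory

section LinearDriver

variable {c z : ℂ} {S : EReal} {T s : ℝ} {γp γm y g : ℝ → ℂ}

theorem continuous_linearDriver (c : ℂ) : Continuous (linearDriver c) :=
  continuous_const.mul Complex.continuous_ofReal

theorem linearDriver_zero (c : ℂ) : linearDriver c 0 = 0 := by simp [linearDriver]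

theorem hasDerivAt_linearDriver (c : ℂ) (s : ℝ) : HasDerivAt (linearDriver c) c s := by
  refine ((hasDerivAt_id s).ofReal_comp.const_mul c).congr_deriv ?_
  simp

theorem mapsTo_const_sub_Ioc (T : ℝ) : MapsTo (fun s => T - s) (Ioc 0 T) (Ico 0 T) :=
  fun _ hs => ⟨sub_nonneg.2 hs.2, sub_lt_self T hs.1⟩

theorem mapsTo_const_sub_Ico (T : ℝ) : MapsTo (fun s => T - s) (Ico 0 T) (Ioc 0 T) :=
  fun _ hs => ⟨sub_pos.2 hs.2, sub_le_self T hs.1⟩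

theorem IsLoewnerSolution.isReverseTrajectory (h : IsLoewnerSolution (linearDriver c) z T g)
    (hlim : Tendsto (fun s => g s - linearDriver c s) (𝓝[<] T) (𝓝 0)) :
    IsReverseTrajectory c T fun s => g (T - s) - linearDriver c (T - s) where
  tendsto_zero := by
    refine hlim.comp (tendsto_nhdsWithin_iff.2 ⟨?_, ?_⟩)
    · exact ((continuous_const.sub continuous_id).tendsto' 0 T (sub_zero T)).mono_left
        nhdsWithin_le_nhds
    · filter_upwards [self_mem_nhdsWithin] with s hs using sub_lt_self T hs
  ne_zero s hs := sub_ne_zero.2 (h.ne_driver _ (mapsTo_const_sub_Ioc T hs))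
  hasDeriv s hs := by
    have hsub : HasDerivWithinAt (fun s : ℝ => T - s) (-1) (Ioc 0 T) s :=
      (hasDerivWithinAt_id s _).const_sub T
    have hg := (h.hasDeriv _ (mapsTo_const_sub_Ioc T hs)).scomp s hsub (mapsTo_const_sub_Ioc T)
    have hdriver := (hasDerivAt_linearDriver c (T - s)).scomp_hasDerivWithinAt s hsub
    refine (hg.sub hdriver).congr_deriv ?_
    simp only [neg_smul, one_smul]
    ring

theorem IsReverseTrajectory.isLoewnerSolution (h : IsReverseTrajectory c T y) :
    IsLoewnerSolution (linearDriver c) (y T) T fun t => y (T - t) + linearDriver c t where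
  initial := by simp [linearDriver_zero]
  ne_driver t ht := by simpa using h.ne_zero _ (mapsTo_const_sub_Ico T ht)
  hasDeriv t ht := by
    have hsub : HasDerivWithinAt (fun s : ℝ => T - s) (-1) (Ico 0 T) t :=
      (hasDerivWithinAt_id t _).const_sub T
    have hy := (h.hasDeriv _ (mapsTo_const_sub_Ico T ht)).scomp t hsub (mapsTo_const_sub_Ico T)
    refine (hy.add (hasDerivAt_linearDriver c t).hasDerivWithinAt).congr_deriv ?_
    simp

theorem IsReverseTrajectory.blowsUpAt (h : IsReverseTrajectory c T y) (hT : 0 < T) :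
    BlowsUpAt (linearDriver c) (y T) T := by
  refine Or.inr ⟨hT, _, h.isLoewnerSolution, ?_⟩
  simp only [add_sub_cancel_right]
  refine h.tendsto_zero.comp (tendsto_nhdsWithin_iff.2 ⟨?_, ?_⟩)
  · exact ((continuous_const.sub continuous_id).tendsto' T 0 (sub_self T)).mono_left
      nhdsWithin_le_nhds
  · filter_upwards [self_mem_nhdsWithin] with s hs using sub_pos.2 (mem_Iio.1 hs)

theorem blowsUpAt_linearDriver_iff (hT : 0 < T) :
    BlowsUpAt (linearDriver c) z T ↔ ∃ y, IsReverseTrajectory c T y ∧ y T = z := by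
  constructor
  · rintro (⟨hT0, -⟩ | ⟨-, g, hg, hlim⟩)
    · exact absurd hT0 hT.ne'
    · exact ⟨_, hg.isReverseTrajectory hlim, by simp [hg.initial, linearDriver_zero]⟩
  · rintro ⟨y, hy, rfl⟩
    exact hy.blowsUpAt hT

theorem IsReverseTrajectory.continuousOn_Ici (h : ∀ T, IsReverseTrajectory c T y) (h0 : y 0 = 0) :
    ContinuousOn y (Ici 0) := by
  intro s hs
  rcases (mem_Ici.1 hs).eq_or_lt with rfl | hs
  · rw [← Ioi_insert, continuousWithinAt_insert_self, ContinuousWithinAt, h0]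
    exact (h 0).tendsto_zero
  · exact ((h (s + 1)).hasDerivAt ⟨hs, lt_add_one s⟩).continuousAt.continuousWithinAt

theorem IsReverseTrajectory.eq_of_lifetime_le (hp : IsReverseTrajectory c T γp)
    (hm : ∀ T : ℝ, T < S → IsReverseTrajectory c T γm) (hmc : ContinuousOn γm (Ici 0))
    (hS : 0 < S) (hne : ∀ T : ℝ, 0 < T → T < S → γp T ≠ γm T) (hrests : ∀ T : ℝ, S ≤ T → γm T = 0)
    (hy : IsReverseTrajectory c T y) (hST : S ≤ T) : y T = γp T := by
  lift S to ℝ using ⟨(hST.trans_lt (EReal.coe_lt_top T)).ne, hS.ne_bot⟩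
  norm_cast at hS hST hm hne hrests
  have hT : 0 < T := hS.trans_le hST
  suffices hmeet : ∃ r ∈ Ioo 0 S, y r = γp r by
    obtain ⟨r, hr, hrp⟩ := hmeet
    exact hy.eqOn_of_eq hp ⟨hr.1, hr.2.le.trans hST⟩ hrp (right_mem_Ioc.2 hT)
  by_contra! hmeet
  have hagree : EqOn y γm (Ioo 0 S) := fun r hr => by
    have hrr : r ∈ Ioc 0 r := right_mem_Ioc.2 hr.1
    have hrT : r ≤ T := hr.2.le.trans hST
    rcases (hy.mono hrT).eqOn_or_eqOn_or_eqOn (hp.mono hrT) (hm r hr.2) hr.1 with heq | heq | heq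
    · exact absurd (heq hrr) (hmeet r hr)
    · exact heq hrr
    · exact absurd (heq hrr) (hne r hr.1 hr.2)
  have hS0 : y S = γm S := hagree.of_subset_closure
    (hy.continuousOn.mono (Ioc_subset_Ioc_right hST)) (hmc.mono fun _ hs => hs.1.le)
    Ioo_subset_Ioc_self (by rw [closure_Ioo hS.ne]; exact Ioc_subset_Icc_self) (right_mem_Ioc.2 hS)
  exact hy.ne_zero S ⟨hS, hST⟩ (hS0.trans (hrests S le_rfl))

theorem isBlowUpPair_of_isReverseTrajectory (hp : ∀ T, IsReverseTrajectory c T γp)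
    (hm : ∀ T : ℝ, T < S → IsReverseTrajectory c T γm) (hp0 : γp 0 = 0) (hm0 : γm 0 = 0)
    (hmc : ContinuousOn γm (Ici 0)) (hS : 0 < S) (hne : ∀ T : ℝ, 0 < T → T < S → γp T ≠ γm T)
    (hrests : ∀ T : ℝ, S ≤ T → γm T = 0) : IsBlowUpPair (linearDriver c) γp γm S where
  pos_zero := hp0.trans (linearDriver_zero c).symm
  neg_zero := hm0.trans (linearDriver_zero c).symm
  pos_continuousOn := IsReverseTrajectory.continuousOn_Ici hp hp0
  neg_continuousOn := hmc
  ne := hne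
  rests T hT := (hrests T hT).trans (linearDriver_zero c).symm
  blowsUpAt_iff T hT z := by
    constructor
    · rw [blowsUpAt_linearDriver_iff hT]
      rintro ⟨y, hy, rfl⟩
      rcases lt_or_ge (T : EReal) S with hTS | hST
      · have hTT : T ∈ Ioc 0 T := right_mem_Ioc.2 hT
        rcases hy.eqOn_or_eqOn_or_eqOn (hp T) (hm T hTS) hT with heq | heq | heq
        · exact Or.inl (heq hTT)
        · exact Or.inr ⟨heq hTT, hTS⟩
        · exact absurd (heq hTT) (hne T hT hTS)
      · exact Or.inl ((hp T).eq_of_lifetime_le hm hmc hS hne hrests hy hST)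
    · rintro (rfl | ⟨rfl, hTS⟩)
      · exact (hp T).blowsUpAt hT
      · exact (hm T hTS).blowsUpAt hT

end LinearDriver

theorem injOn_of_convex_of_re_deriv_pos {f f' : ℂ → ℂ} {D : Set ℂ} (hD : Convex ℝ D)
    (hf : ∀ z ∈ D, HasDerivAt f (f' z) z) (k : ℂ) (hk : ∀ z ∈ D, 0 < (k * f' z).re) :
    InjOn f D := by
  intro z hz w hw heq
  by_contra hne
  have hwz : w - z ≠ 0 := sub_ne_zero.2 (Ne.symm hne)
  have hmem : ∀ t ∈ Icc (0 : ℝ) 1, z + t * (w - z) ∈ D := fun t ht => by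
    simpa using hD.add_smul_sub_mem hz hw ht
  have hderiv : ∀ t ∈ Icc (0 : ℝ) 1, HasDerivAt
      (fun t : ℝ => (k / (w - z) * f (z + t * (w - z))).re)
      (k * f' (z + t * (w - z))).re t := fun t ht => by
    have hline : HasDerivAt (fun t : ℝ => z + t * (w - z)) (1 * (w - z)) t :=
      ((hasDerivAt_id t).ofReal_comp.mul_const (w - z)).const_add z
    have hcomp := ((hf _ (hmem t ht)).scomp t hline).const_mul (k / (w - z))
    refine (Complex.reCLM.hasFDerivAt.comp_hasDerivAt t hcomp).congr_deriv ?_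
    simp only [Complex.reCLM_apply, smul_eq_mul]
    congr 1
    field_simp
  have hmono : StrictMonoOn (fun t : ℝ => (k / (w - z) * f (z + t * (w - z))).re) (Icc 0 1) :=
    strictMonoOn_of_hasDerivWithinAt_pos (convex_Icc 0 1)
      (fun t ht => (hderiv t ht).continuousAt.continuousWithinAt)
      (fun t ht => (hderiv t (interior_subset ht)).hasDerivWithinAt)
      (fun t ht => hk _ (hmem t (interior_subset ht)))
  have := hmono (left_mem_Icc.2 zero_le_one) (right_mem_Icc.2 zero_le_one) zero_lt_one
  simp [heq] at this

theorem continuousOn_of_rightInvOn {X Y : Type*} [TopologicalSpace X] [TopologicalSpace Y]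
    {f : X → Y} {g : Y → X} {D : Set X} {V : Set Y} (hD : IsOpen D)
    (hf : ∀ x ∈ D, 𝓝 (f x) ≤ map f (𝓝 x)) (hinj : InjOn f (D ∩ f ⁻¹' V)) (hg : MapsTo g V D)
    (hfg : RightInvOn g f V) : ContinuousOn g V := by
  intro y hy
  rw [ContinuousWithinAt, tendsto_def]
  intro N hN
  have himage : f '' (N ∩ D) ∈ 𝓝 y := by
    have := hf (g y) (hg hy) (image_mem_map (inter_mem hN (hD.mem_nhds (hg hy))))
    rwa [hfg hy] at this
  filter_upwards [mem_nhdsWithin_of_mem_nhds himage, self_mem_nhdsWithin]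
  rintro _ ⟨x, hx, rfl⟩ hfx
  have hgx : g (f x) = x :=
    hinj ⟨hg hfx, by rwa [mem_preimage, hfg hfx]⟩ ⟨hx.2, hfx⟩ (hfg hfx)
  rw [mem_preimage, hgx]
  exact hx.1

/-- In the coordinate `ζ = log (1 - c y / 2)`, the reverse Loewner flow `y' = c - 2 / y` of the
driver `t ↦ c t` becomes the flow along which this function grows at the constant speed
`c ^ 2 / 2`. -/
noncomputable def potential (ζ : ℂ) : ℂ := 1 + ζ - Complex.exp ζ

theorem potential_re (ζ : ℂ) :
    (potential ζ).re = 1 + ζ.re - Real.exp ζ.re * Real.cos ζ.im := by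
  simp [potential, Complex.exp_re]

theorem potential_im (ζ : ℂ) : (potential ζ).im = ζ.im - Real.exp ζ.re * Real.sin ζ.im := by
  simp [potential, Complex.exp_im]

theorem potential_zero : potential 0 = 0 := by simp [potential]

theorem potential_conj (ζ : ℂ) : potential (conj ζ) = conj (potential ζ) := by
  simp [potential, ← Complex.exp_conj]

theorem potential_add_int_mul (ζ : ℂ) (n : ℤ) :
    potential (ζ + n * (2 * π * Complex.I)) = potential ζ + n * (2 * π * Complex.I) := by
  have hexp : Complex.exp (ζ + n * (2 * π * Complex.I)) = Complex.exp ζ :=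
    Complex.exp_eq_exp_iff_exists_int.2 ⟨n, rfl⟩
  simp only [potential, hexp]
  ring

theorem hasStrictDerivAt_potential (ζ : ℂ) :
    HasStrictDerivAt potential (1 - Complex.exp ζ) ζ :=
  ((hasStrictDerivAt_id ζ).const_add 1).sub (Complex.hasStrictDerivAt_exp ζ)

theorem continuous_potential : Continuous potential := by
  unfold potential; fun_prop

theorem map_nhds_potential {ζ : ℂ} (h : Complex.exp ζ ≠ 1) :
    map potential (𝓝 ζ) = 𝓝 (potential ζ) :=
  (hasStrictDerivAt_potential ζ).map_nhds_eq (sub_ne_zero.2 h.symm)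

theorem norm_le_norm_potential_add_two {ζ : ℂ} (h : ζ.re ≤ 0) : ‖ζ‖ ≤ ‖potential ζ‖ + 2 := by
  calc ‖ζ‖ = ‖potential ζ + (Complex.exp ζ - 1)‖ := by rw [potential]; congr 1; ring
    _ ≤ ‖potential ζ‖ + (‖Complex.exp ζ‖ + ‖(1 : ℂ)‖) :=
      (norm_add_le _ _).trans (by gcongr; exact norm_sub_le _ _)
    _ ≤ ‖potential ζ‖ + (1 + 1) := by
      rw [Complex.norm_exp, norm_one]; gcongr; exact Real.exp_le_one_iff.2 h
    _ = ‖potential ζ‖ + 2 := by ring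

theorem exp_re_le_norm_potential (ζ : ℂ) : Real.exp ζ.re ≤ 1 + ‖ζ‖ + ‖potential ζ‖ := by
  calc Real.exp ζ.re = ‖1 + ζ - potential ζ‖ := by rw [← Complex.norm_exp, potential]; simp
    _ ≤ ‖1 + ζ‖ + ‖potential ζ‖ := norm_sub_le _ _
    _ ≤ ‖(1 : ℂ)‖ + ‖ζ‖ + ‖potential ζ‖ := by gcongr; exact norm_add_le _ _
    _ = 1 + ‖ζ‖ + ‖potential ζ‖ := by rw [norm_one]

theorem re_le_norm_potential {ζ : ℂ} (h : 0 ≤ ζ.re) :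
    ζ.re ≤ 1 + 2 * (|ζ.im| + ‖potential ζ‖) := by
  have hnorm : ‖ζ‖ ≤ ζ.re + |ζ.im| := by
    simpa only [abs_of_nonneg h] using Complex.norm_le_abs_re_add_abs_im ζ
  have hexp := exp_re_le_norm_potential ζ
  have hquad := Real.quadratic_le_exp_of_nonneg h
  have : ζ.re ^ 2 ≤ 2 * (|ζ.im| + ‖potential ζ‖) := by linarith
  nlinarith

/-- The union of the closed left half-plane and a closed horizontal strip. The potential is a proper
map on it and has no zero in it besides `0`. -/
def properDomain : Set ℂ := {ζ | ζ.re ≤ 0 ∨ |ζ.im| ≤ 2 * π}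

theorem isClosed_properDomain : IsClosed properDomain :=
  (isClosed_le Complex.continuous_re continuous_const).union
    (isClosed_le Complex.continuous_im.abs continuous_const)

theorem exists_norm_le_of_norm_potential_le (M : ℝ) :
    ∃ C, ∀ ζ ∈ properDomain, ‖potential ζ‖ ≤ M → ‖ζ‖ ≤ C := by
  refine ⟨2 + 1 + 6 * π + 2 * M, fun ζ hζ hM => ?_⟩
  have hM0 : 0 ≤ M := (norm_nonneg _).trans hM
  have hpi := Real.pi_pos
  rcases le_or_gt ζ.re 0 with hre | hre
  · linarith [norm_le_norm_potential_add_two hre]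
  · have him : |ζ.im| ≤ 2 * π := hζ.resolve_left hre.not_ge
    have hnorm := Complex.norm_le_abs_re_add_abs_im ζ
    rw [abs_of_pos hre] at hnorm
    linarith [re_le_norm_potential hre.le]

theorem isClosed_potential_image {K : Set ℂ} (hK : IsClosed K) (hKp : K ⊆ properDomain) :
    IsClosed (potential '' K) := by
  refine isClosed_of_closure_subset fun w hw => ?_
  obtain ⟨C, hC⟩ := exists_norm_le_of_norm_potential_le (‖w‖ + 1)
  have hcompact : IsCompact (potential '' (K ∩ Metric.closedBall 0 C)) :=
    ((isCompact_closedBall 0 C).inter_left hK).image continuous_potential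
  have hsub : Metric.ball w 1 ∩ potential '' K ⊆ potential '' (K ∩ Metric.closedBall 0 C) := by
    rintro _ ⟨hball, ζ, hζ, rfl⟩
    refine ⟨ζ, ⟨hζ, mem_closedBall_zero_iff.2 (hC ζ (hKp hζ) ?_)⟩, rfl⟩
    have := norm_sub_norm_le (potential ζ) w
    rw [mem_ball_iff_norm] at hball
    linarith
  have hmem := Metric.isOpen_ball.inter_closure ⟨Metric.mem_ball_self one_pos, hw⟩
  exact image_mono inter_subset_left (closure_minimal hsub hcompact.isClosed hmem)

theorem mul_cos_lt_sin {y : ℝ} (h0 : 0 < y) (hpi : y < π) : y * Real.cos y < Real.sin y := by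
  have hs := Real.sin_pos_of_pos_of_lt_pi h0 hpi
  rcases lt_or_ge y (π / 2) with h | h
  · have hc : 0 < Real.cos y := Real.cos_pos_of_mem_Ioo ⟨by linarith, h⟩
    have := Real.lt_tan h0 h
    rwa [Real.tan_eq_sin_div_cos, lt_div_iff₀ hc] at this
  · have hc : Real.cos y ≤ 0 := Real.cos_nonpos_of_pi_div_two_le_of_le h (by linarith)
    nlinarith

theorem sin_nonpos_of_pi_le_of_le_two_pi {y : ℝ} (hpi : π ≤ y) (h2pi : y ≤ 2 * π) :
    Real.sin y ≤ 0 := by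
  have := Real.sin_nonneg_of_nonneg_of_le_pi (x := 2 * π - y) (by linarith) (by linarith)
  rwa [Real.sin_two_pi_sub, Left.nonneg_neg_iff] at this

theorem potential_im_neg {ζ : ℂ} (hre : 0 < ζ.re) (him : 0 < ζ.im) (hpi : ζ.im < π)
    (h : (potential ζ).re ≤ 0) : (potential ζ).im < 0 := by
  rw [potential_re] at h
  rw [potential_im]
  have := mul_lt_mul_of_pos_left (mul_cos_lt_sin him hpi) (Real.exp_pos ζ.re)
  nlinarith

theorem potential_im_pos {ζ : ℂ} (hre : 0 < ζ.re) (him : ζ.im < 0) (hpi : -π < ζ.im)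
    (h : (potential ζ).re ≤ 0) : 0 < (potential ζ).im := by
  have := potential_im_neg (ζ := conj ζ) (by simpa) (by simpa) (by simp; linarith)
    (by simpa [potential_conj])
  simpa [potential_conj] using this

theorem potential_ne_zero_of_im_pos {ζ : ℂ} (hζ : ζ ∈ properDomain) (him : 0 < ζ.im) :
    potential ζ ≠ 0 := by
  intro h
  have hsin : Real.exp ζ.re * Real.sin ζ.im = ζ.im := by
    have := potential_im ζ
    rw [h, Complex.zero_im] at this
    linarith
  have hsin_pos : 0 < Real.sin ζ.im :=
    pos_of_mul_pos_right (hsin ▸ him) (Real.exp_pos _).le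
  have hre : 0 < ζ.re := by
    by_contra! hre
    have : Real.exp ζ.re * Real.sin ζ.im ≤ 1 * Real.sin ζ.im := by
      gcongr; exact Real.exp_le_one_iff.2 hre
    linarith [Real.sin_lt him]
  have him2 : ζ.im ≤ 2 * π := (le_abs_self _).trans (hζ.resolve_left hre.not_ge)
  have hpi : ζ.im < π := by
    by_contra! hpi
    exact (sin_nonpos_of_pi_le_of_le_two_pi hpi him2).not_gt hsin_pos
  have := potential_im_neg hre him hpi (by simp [h])
  simp [h] at this

theorem eq_zero_of_potential_eq_zero {ζ : ℂ} (hζ : ζ ∈ properDomain) (h : potential ζ = 0) :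
    ζ = 0 := by
  have him : ζ.im = 0 := by
    rcases lt_trichotomy ζ.im 0 with him | him | him
    · refine absurd ?_ (potential_ne_zero_of_im_pos (ζ := conj ζ) ?_ (by simpa using him))
      · rw [potential_conj, h, map_zero]
      · simpa [properDomain] using hζ
    · exact him
    · exact absurd h (potential_ne_zero_of_im_pos hζ him)
  have hre := potential_re ζ
  rw [h, him, Real.cos_zero, mul_one, Complex.zero_re] at hre
  refine Complex.ext ?_ him
  by_contra hne
  have := Real.add_one_lt_exp hne
  linarith

theorem tendsto_of_tendsto_potential {α : Type*} {l : Filter α} {ζ : α → ℂ} {p : ℂ} {K : Set ℂ}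
    (hK : IsClosed K) (hKp : K ⊆ properDomain) (hζ : ∀ᶠ s in l, ζ s ∈ K)
    (hlim : Tendsto (fun s => potential (ζ s)) l (𝓝 (potential p)))
    (huniq : ∀ q ∈ K, potential q = potential p → q = p) : Tendsto ζ l (𝓝 p) := by
  obtain ⟨C, hC⟩ := exists_norm_le_of_norm_potential_le (‖potential p‖ + 1)
  have hcompact : IsCompact (K ∩ Metric.closedBall 0 C) :=
    (isCompact_closedBall 0 C).inter_left hK
  refine hcompact.tendsto_nhds_of_unique_mapClusterPt ?_ fun q hq hcl => huniq q hq.1 ?_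
  · have := hlim.norm.eventually_le_const (lt_add_one ‖potential p‖)
    filter_upwards [hζ, this] with s hs hnorm
    exact ⟨hs, by simpa using hC _ (hKp hs) hnorm⟩
  · have hpot : MapClusterPt (potential q) l (fun s => potential (ζ s)) :=
      hcl.continuousAt_comp continuous_potential.continuousAt
    exact eq_of_nhds_neBot (hpot.neBot.mono (inf_le_inf_left _ hlim))

theorem exists_potential_inverse {D V : Set ℂ} (hD : IsOpen D)
    (hcrit : ∀ ζ ∈ D, Complex.exp ζ ≠ 1) (hproper : D ⊆ properDomain) (hV : IsPreconnected V)
    (hcl : ∀ ζ ∈ closure D, potential ζ ∈ V → ζ ∈ D)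
    (hinj : InjOn potential (D ∩ potential ⁻¹' V)) (hne : (D ∩ potential ⁻¹' V).Nonempty) :
    ∃ G : ℂ → ℂ, ContinuousOn G V ∧ MapsTo G V D ∧ RightInvOn G potential V := by
  have hopen : IsOpen (potential '' D) := by
    rw [isOpen_iff_mem_nhds]
    rintro _ ⟨ζ, hζ, rfl⟩
    rw [← map_nhds_potential (hcrit ζ hζ)]
    exact image_mem_map (hD.mem_nhds hζ)
  have hclosure : closure (potential '' D) ⊆ potential '' closure D :=
    closure_minimal (image_mono subset_closure) (isClosed_potential_image isClosed_closure
      (closure_minimal hproper isClosed_properDomain))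
  have hsub : V ⊆ potential '' D := by
    refine hV.subset_of_closure_inter_subset hopen ?_ ?_
    · obtain ⟨ζ, hζ, hζV⟩ := hne
      exact ⟨potential ζ, hζV, mem_image_of_mem potential hζ⟩
    · rintro w ⟨hw, hwV⟩
      obtain ⟨ζ, hζ, rfl⟩ := hclosure hw
      exact mem_image_of_mem potential (hcl ζ hζ hwV)
  choose! G hGD hG using hsub
  exact ⟨G, continuousOn_of_rightInvOn hD (fun ζ hζ => (map_nhds_potential (hcrit ζ hζ)).ge) hinj
    hGD hG, hGD, hG⟩

theorem exp_ne_one_of_re_ne_zero {ζ : ℂ} (h : ζ.re ≠ 0) : Complex.exp ζ ≠ 1 := fun he => by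
  have := congrArg norm he
  rw [Complex.norm_exp, norm_one, Real.exp_eq_one_iff] at this
  exact h this

theorem exp_ne_one_of_im_mem_Ioo {ζ : ℂ} (h : ζ.im ∈ Ioo 0 (2 * π)) : Complex.exp ζ ≠ 1 := by
  intro he
  obtain ⟨n, rfl⟩ := Complex.exp_eq_one_iff.1 he
  have him : (n * (2 * π * Complex.I)).im = n * (2 * π) := by simp
  rw [him] at h
  have hpos : 0 < 2 * π := Real.two_pi_pos
  have h0 : (0 : ℤ) < n := by exact_mod_cast pos_of_mul_pos_left h.1 hpos.le
  have h1 : n < (1 : ℤ) := by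
    exact_mod_cast lt_of_mul_lt_mul_right (h.2.trans_eq (one_mul _).symm) hpos.le
  omega

theorem injOn_potential_of_convex {D : Set ℂ} (hD : Convex ℝ D) (k : ℂ)
    (hk : ∀ ζ ∈ D, 0 < (k * (1 - Complex.exp ζ)).re) : InjOn potential D :=
  injOn_of_convex_of_re_deriv_pos hD (fun ζ _ => (hasStrictDerivAt_potential ζ).hasDerivAt) k hk

theorem injOn_potential_re_neg : InjOn potential {ζ | ζ.re < 0} := by
  refine injOn_potential_of_convex (convex_halfSpace_re_lt 0) 1 fun ζ hζ => ?_
  have hexp : Real.exp ζ.re < 1 := Real.exp_lt_one_iff.2 hζ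
  have hcos := Real.cos_le_one ζ.im
  have hpos := Real.exp_pos ζ.re
  simp only [one_mul, Complex.sub_re, Complex.one_re, Complex.exp_re]
  nlinarith

theorem injOn_potential_of_sin_pos {a b : ℝ} (h : ∀ y ∈ Ioo a b, 0 < Real.sin y) :
    InjOn potential {ζ | ζ.im ∈ Ioo a b} := by
  refine injOn_potential_of_convex
    ((convex_halfSpace_im_gt a).inter (convex_halfSpace_im_lt b)) Complex.I fun ζ hζ => ?_
  simpa [Complex.exp_im] using mul_pos (Real.exp_pos ζ.re) (h ζ.im hζ)

theorem injOn_potential_of_sin_neg {a b : ℝ} (h : ∀ y ∈ Ioo a b, Real.sin y < 0) :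
    InjOn potential {ζ | ζ.im ∈ Ioo a b} := by
  refine injOn_potential_of_convex
    ((convex_halfSpace_im_gt a).inter (convex_halfSpace_im_lt b)) (-Complex.I) fun ζ hζ => ?_
  simpa [Complex.exp_im] using mul_neg_of_pos_of_neg (Real.exp_pos ζ.re) (h ζ.im hζ)

theorem injOn_potential_im_eq_pi : InjOn potential {ζ | ζ.im = π} := by
  refine injOn_potential_of_convex (convex_hyperplane Complex.imLm.isLinear _) 1 fun ζ hζ => ?_
  rw [mem_ofPred_eq] at hζ
  simp only [one_mul, Complex.sub_re, Complex.one_re, Complex.exp_re, hζ, Real.cos_pi]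
  linarith [Real.exp_pos ζ.re]

theorem injOn_potential_pos_real : InjOn potential {ζ | ζ.im = 0 ∧ 0 < ζ.re} := by
  refine injOn_potential_of_convex
    ((convex_hyperplane Complex.imLm.isLinear _).inter (convex_halfSpace_re_gt 0)) (-1)
    fun ζ hζ => ?_
  have him : ζ.im = 0 := hζ.1
  have hexp := Real.one_lt_exp_iff.2 hζ.2
  simp only [neg_mul, one_mul, Complex.neg_re, Complex.sub_re, Complex.one_re, Complex.exp_re,
    him, Real.cos_zero]
  linarith

theorem sin_neg_of_mem_Ioo_pi_two_pi {y : ℝ} (h : y ∈ Ioo π (2 * π)) : Real.sin y < 0 := by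
  have := Real.sin_pos_of_pos_of_lt_pi (x := 2 * π - y) (by linarith [h.2]) (by linarith [h.1])
  rwa [Real.sin_two_pi_sub, Left.neg_pos_iff] at this

theorem sign_potential_im {ζ : ℂ} (hre : 0 < ζ.re) (him : |ζ.im| < π)
    (h : (potential ζ).re ≤ 0) : SignType.sign (potential ζ).im = -SignType.sign ζ.im := by
  rw [abs_lt] at him
  rcases lt_trichotomy ζ.im 0 with hζ | hζ | hζ
  · rw [sign_neg hζ, neg_neg, sign_pos (potential_im_pos hre hζ him.1 h)]
  · simp [potential_im, hζ]
  · rw [sign_pos hζ, sign_neg (potential_im_neg hre hζ him.2 h)]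

theorem injOn_potential_right :
    InjOn potential ({ζ | 0 < ζ.re ∧ |ζ.im| < π} ∩ potential ⁻¹' {w | w.re ≤ 0}) := by
  rintro z ⟨⟨hz, hzπ⟩, hz0⟩ w ⟨⟨hw, hwπ⟩, hw0⟩ heq
  have hsign : SignType.sign z.im = SignType.sign w.im := by
    rw [← neg_inj, ← sign_potential_im hz hzπ hz0, ← sign_potential_im hw hwπ hw0, heq]
  rw [abs_lt] at hzπ hwπ
  rcases lt_trichotomy z.im 0 with h | h | h
  · rw [sign_neg h, eq_comm, sign_eq_neg_one_iff] at hsign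
    exact injOn_potential_of_sin_neg (fun y hy => Real.sin_neg_of_neg_of_neg_pi_lt hy.2 hy.1)
      ⟨hzπ.1, h⟩ ⟨hwπ.1, hsign⟩ heq
  · rw [h, sign_zero, eq_comm, sign_eq_zero_iff] at hsign
    exact injOn_potential_pos_real ⟨h, hz⟩ ⟨hsign, hw⟩ heq
  · rw [sign_pos h, eq_comm, sign_eq_one_iff] at hsign
    exact injOn_potential_of_sin_pos (fun y hy => Real.sin_pos_of_mem_Ioo hy)
      ⟨h, hzπ.2⟩ ⟨hsign, hwπ.2⟩ heq

theorem sign_potential_im_sub_pi {ζ : ℂ} (h : ζ.im ∈ Ioo 0 (2 * π)) :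
    SignType.sign ((potential ζ).im - π) = SignType.sign (ζ.im - π) := by
  have hexp := Real.exp_pos ζ.re
  rw [potential_im]
  rcases lt_trichotomy ζ.im π with hζ | hζ | hζ
  · have := mul_pos hexp (Real.sin_pos_of_pos_of_lt_pi h.1 hζ)
    rw [sign_neg (sub_neg.2 hζ), sign_neg (by linarith)]
  · simp [hζ]
  · have := mul_neg_of_pos_of_neg hexp (sin_neg_of_mem_Ioo_pi_two_pi ⟨hζ, h.2⟩)
    rw [sign_pos (sub_pos.2 hζ), sign_pos (by linarith)]

theorem injOn_potential_upper : InjOn potential {ζ | ζ.im ∈ Ioo 0 (2 * π)} := by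
  intro z hz w hw heq
  have hsign : SignType.sign (z.im - π) = SignType.sign (w.im - π) := by
    rw [← sign_potential_im_sub_pi hz, ← sign_potential_im_sub_pi hw, heq]
  rcases lt_trichotomy z.im π with h | h | h
  · rw [sign_neg (sub_neg.2 h), eq_comm, sign_eq_neg_one_iff, sub_neg] at hsign
    exact injOn_potential_of_sin_pos (fun y hy => Real.sin_pos_of_mem_Ioo hy)
      ⟨hz.1, h⟩ ⟨hw.1, hsign⟩ heq
  · rw [h, sub_self, sign_zero, eq_comm, sign_eq_zero_iff, sub_eq_zero] at hsign
    exact injOn_potential_im_eq_pi h hsign heq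
  · rw [sign_pos (sub_pos.2 h), eq_comm, sign_eq_one_iff, sub_pos] at hsign
    exact injOn_potential_of_sin_neg (fun y hy => sin_neg_of_mem_Ioo_pi_two_pi hy)
      ⟨h, hz.2⟩ ⟨hsign, hw.2⟩ heq

theorem isPreconnected_of_re_nonpos {V : Set ℂ} (hV : {w : ℂ | w.re < 0} ⊆ V)
    (hV' : V ⊆ {w | w.re ≤ 0}) : IsPreconnected V :=
  (convex_halfSpace_re_lt 0).isPreconnected.subset_closure hV
    (by rwa [Complex.closure_setOfPred_re_lt])

theorem cos_im_eq_one_of_potential_re_nonpos {ζ : ℂ} (hre : ζ.re = 0)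
    (h : (potential ζ).re ≤ 0) : Real.cos ζ.im = 1 := by
  rw [potential_re, hre, Real.exp_zero] at h
  exact le_antisymm (Real.cos_le_one _) (by linarith)

theorem exists_left_inverse_potential : ∃ G : ℂ → ℂ,
    ContinuousOn G {w | w.re ≤ 0 ∧ ∀ n : ℤ, w ≠ n * (2 * π * Complex.I)} ∧
    MapsTo G {w | w.re ≤ 0 ∧ ∀ n : ℤ, w ≠ n * (2 * π * Complex.I)} {ζ | ζ.re < 0} ∧
    RightInvOn G potential {w | w.re ≤ 0 ∧ ∀ n : ℤ, w ≠ n * (2 * π * Complex.I)} := by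
  have hhalf : {w : ℂ | w.re < 0} ⊆ {w | w.re ≤ 0 ∧ ∀ n : ℤ, w ≠ n * (2 * π * Complex.I)} :=
    fun w hw => ⟨le_of_lt hw, fun n hn => by simp [hn] at hw⟩
  refine exists_potential_inverse (isOpen_lt Complex.continuous_re continuous_const)
    (fun ζ hζ => exp_ne_one_of_re_ne_zero (ne_of_lt hζ)) (fun ζ hζ => Or.inl (le_of_lt hζ))
    (isPreconnected_of_re_nonpos hhalf fun w hw => hw.1) (fun ζ hζ hV => ?_)
    (injOn_potential_re_neg.mono inter_subset_left) ⟨-1, by simp, hhalf ?_⟩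
  · rw [Complex.closure_setOfPred_re_lt] at hζ
    refine lt_of_le_of_ne (show ζ.re ≤ 0 from hζ) fun hre => ?_
    obtain ⟨n, hn⟩ := (Real.cos_eq_one_iff _).1 (cos_im_eq_one_of_potential_re_nonpos hre hV.1)
    have hζn : ζ = 0 + n * (2 * π * Complex.I) :=
      Complex.ext (by simp [hre]) (by simp [← hn])
    exact hV.2 n (by rw [hζn, potential_add_int_mul, potential_zero, zero_add])
  · simp [potential_re, Real.exp_pos]

theorem exists_right_inverse_potential : ∃ G : ℂ → ℂ,
    ContinuousOn G {w | w.re ≤ 0 ∧ w ≠ 0} ∧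
    MapsTo G {w | w.re ≤ 0 ∧ w ≠ 0} {ζ | 0 < ζ.re ∧ |ζ.im| < π} ∧
    RightInvOn G potential {w | w.re ≤ 0 ∧ w ≠ 0} := by
  have hpi := Real.pi_pos
  have hhalf : {w : ℂ | w.re < 0} ⊆ {w | w.re ≤ 0 ∧ w ≠ 0} :=
    fun w hw => ⟨le_of_lt hw, fun h0 => by simp [h0] at hw⟩
  refine exists_potential_inverse ((isOpen_lt continuous_const Complex.continuous_re).inter
      (isOpen_lt Complex.continuous_im.abs continuous_const))
    (fun ζ hζ => exp_ne_one_of_re_ne_zero (ne_of_gt hζ.1))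
    (fun ζ hζ => Or.inr (by linarith [hζ.2]))
    (isPreconnected_of_re_nonpos hhalf fun w hw => hw.1) (fun ζ hζ hV => ?_)
    (injOn_potential_right.mono (inter_subset_inter_right _ (preimage_mono fun w hw => hw.1)))
    ⟨1, ?_, hhalf ?_⟩
  · have hζ' : 0 ≤ ζ.re ∧ |ζ.im| ≤ π :=
      closure_minimal (t := {z : ℂ | 0 ≤ z.re ∧ |z.im| ≤ π})
        (fun z hz => And.intro (le_of_lt hz.1) (le_of_lt hz.2))
        ((isClosed_le continuous_const Complex.continuous_re).inter
          (isClosed_le Complex.continuous_im.abs continuous_const)) hζ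
    have him : |ζ.im| < π := by
      refine lt_of_le_of_ne hζ'.2 fun h => ?_
      have hre := hV.1
      rw [potential_re, ← Real.cos_abs, h, Real.cos_pi] at hre
      linarith [Real.exp_pos ζ.re]
    refine ⟨lt_of_le_of_ne hζ'.1 fun hre => ?_, him⟩
    have hcos := cos_im_eq_one_of_potential_re_nonpos hre.symm hV.1
    rw [abs_lt] at him
    have hζ0 : ζ.im = 0 :=
      (Real.cos_eq_one_iff_of_lt_of_lt (by linarith) (by linarith)).1 hcos
    exact hV.2 (by rw [show ζ = 0 from Complex.ext hre.symm hζ0, potential_zero])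
  · exact ⟨by simp, by simpa using hpi⟩
  · have := Real.exp_one_gt_d9
    simp only [mem_ofPred_eq, potential_re, Complex.one_re, Complex.one_im, Real.cos_zero, mul_one]
    linarith

theorem exists_upper_inverse_potential : ∃ G : ℂ → ℂ,
    ContinuousOn G {w | 0 < w.re} ∧ MapsTo G {w | 0 < w.re} {ζ | ζ.im ∈ Ioo 0 (2 * π)} ∧
    RightInvOn G potential {w | 0 < w.re} := by
  have hpi := Real.pi_pos
  refine exists_potential_inverse (isOpen_Ioo.preimage Complex.continuous_im)
    (fun ζ hζ => exp_ne_one_of_im_mem_Ioo hζ)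
    (fun ζ hζ => Or.inr (by rw [abs_of_pos hζ.1]; exact hζ.2.le))
    (convex_halfSpace_re_gt 0).isPreconnected (fun ζ hζ hV => ?_)
    (injOn_potential_upper.mono inter_subset_left)
    ⟨π * Complex.I, by simp [hpi], by simp [potential_re]⟩
  have hζ' : ζ.im ∈ Icc 0 (2 * π) :=
    closure_minimal (preimage_mono Ioo_subset_Icc_self)
      (isClosed_Icc.preimage Complex.continuous_im) hζ
  have hcos : Real.cos ζ.im ≠ 1 := fun hcos => by
    rw [mem_ofPred_eq, potential_re, hcos, mul_one] at hV
    linarith [Real.add_one_le_exp ζ.re]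
  refine ⟨lt_of_le_of_ne hζ'.1 fun h => hcos ?_, lt_of_le_of_ne hζ'.2 fun h => hcos ?_⟩
  · rw [← h, Real.cos_zero]
  · rw [h, Real.cos_two_pi]

/-- A continuous lift, starting at `0`, of the ray segment `s ↦ a * s`, `0 ≤ s < S`, under the
potential, which avoids the critical points of the potential for `s > 0`. -/
structure IsRayLift (a : ℂ) (S : ℝ) (ζ : ℝ → ℂ) : Prop where
  zero : ζ 0 = 0
  continuousOn : ContinuousOn ζ (Ico 0 S)
  potential_eq : ∀ s ∈ Ioo 0 S, potential (ζ s) = a * s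
  exp_ne_one : ∀ s ∈ Ioo 0 S, Complex.exp (ζ s) ≠ 1

theorem continuousWithinAt_zero_of_potential_eq {ζ : ℝ → ℂ} {a : ℂ} {S : ℝ} (h0 : ζ 0 = 0)
    (hζ : ∀ s ∈ Ioo 0 S, ζ s ∈ properDomain ∧ potential (ζ s) = a * s) :
    ContinuousWithinAt ζ (Ioo 0 S) 0 := by
  rw [ContinuousWithinAt, h0]
  refine tendsto_of_tendsto_potential isClosed_properDomain subset_rfl
    (eventually_of_mem self_mem_nhdsWithin fun s hs => (hζ s hs).1) ?_
    fun q hq hpot => eq_zero_of_potential_eq_zero hq (hpot.trans potential_zero)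
  have hlim : Tendsto (fun s : ℝ => a * (s : ℂ)) (𝓝[Ioo 0 S] 0) (𝓝 (potential 0)) := by
    have hcont : Continuous fun s : ℝ => a * (s : ℂ) := by fun_prop
    simpa [potential_zero] using (hcont.tendsto 0).mono_left nhdsWithin_le_nhds
  exact hlim.congr' (eventually_of_mem self_mem_nhdsWithin fun s hs => (hζ s hs).2.symm)

theorem exists_isRayLift_of_inverse {G : ℂ → ℂ} {V D : Set ℂ} (hG : ContinuousOn G V)
    (hGD : MapsTo G V D) (hinv : RightInvOn G potential V) (hD : D ⊆ properDomain)
    (hcrit : ∀ ζ ∈ D, Complex.exp ζ ≠ 1) (a : ℂ) :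
    ∃ ζ : ℝ → ℂ, ∀ S, (∀ s ∈ Ioo (0 : ℝ) S, a * s ∈ V) →
      IsRayLift a S ζ ∧ ∀ s ∈ Ioo 0 S, ζ s ∈ D := by
  set ζ : ℝ → ℂ := Function.update (fun s : ℝ => G (a * s)) 0 0
  have hζ : ∀ s > 0, ζ s = G (a * s) := fun s hs => Function.update_of_ne hs.ne' _ _
  refine ⟨ζ, fun S hray => ?_⟩
  have hζD : ∀ s ∈ Ioo 0 S, ζ s ∈ D := fun s hs => hζ s hs.1 ▸ hGD (hray s hs)
  have hpot : ∀ s ∈ Ioo 0 S, potential (ζ s) = a * s := fun s hs => by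
    rw [hζ s hs.1, hinv (hray s hs)]
  have hzero : ζ 0 = 0 := Function.update_self _ _ _
  refine ⟨⟨hzero, fun s hs => ?_, hpot, fun s hs => hcrit _ (hζD s hs)⟩, hζD⟩
  rcases hs.1.eq_or_lt with rfl | h0
  · rw [← Ioo_insert_left hs.2, continuousWithinAt_insert_self]
    exact continuousWithinAt_zero_of_potential_eq hzero fun s hs => ⟨hD (hζD s hs), hpot s hs⟩
  · have hmul : Continuous fun s : ℝ => a * (s : ℂ) := by fun_prop
    have hcont : ContinuousOn ζ (Ioo 0 S) :=
      (hG.comp hmul.continuousOn hray).congr fun s hs => hζ s hs.1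
    exact (hcont.continuousAt (Ioo_mem_nhds h0 hs.2)).continuousWithinAt

theorem re_mul_ofReal_nonpos {a : ℂ} (ha : a.re ≤ 0) {s : ℝ} (hs : 0 ≤ s) : (a * s).re ≤ 0 := by
  rw [Complex.re_mul_ofReal]
  exact mul_nonpos_of_nonpos_of_nonneg ha hs

theorem exists_isRayLift_left {a : ℂ} (ha : a.re ≤ 0) : ∃ ζ : ℝ → ℂ, ∀ S,
    (∀ s ∈ Ioo (0 : ℝ) S, ∀ n : ℤ, a * s ≠ n * (2 * π * Complex.I)) →
      IsRayLift a S ζ ∧ ∀ s ∈ Ioo 0 S, (ζ s).re < 0 := by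
  obtain ⟨G, hG, hGD, hinv⟩ := exists_left_inverse_potential
  obtain ⟨ζ, hζ⟩ := exists_isRayLift_of_inverse hG hGD hinv (fun ζ hζ => Or.inl (le_of_lt hζ))
    (fun ζ hζ => exp_ne_one_of_re_ne_zero (ne_of_lt hζ)) a
  exact ⟨ζ, fun S hS => hζ S fun s hs => ⟨re_mul_ofReal_nonpos ha hs.1.le, hS s hs⟩⟩

theorem exists_isRayLift_right {a : ℂ} (ha : a.re ≤ 0) (ha0 : a ≠ 0) : ∃ ζ : ℝ → ℂ, ∀ S,
    IsRayLift a S ζ ∧ ∀ s ∈ Ioo 0 S, 0 < (ζ s).re ∧ |(ζ s).im| < π := by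
  obtain ⟨G, hG, hGD, hinv⟩ := exists_right_inverse_potential
  obtain ⟨ζ, hζ⟩ := exists_isRayLift_of_inverse hG hGD hinv
    (fun ζ hζ => Or.inr (by linarith [hζ.2, Real.pi_pos]))
    (fun ζ hζ => exp_ne_one_of_re_ne_zero (ne_of_gt hζ.1)) a
  exact ⟨ζ, fun S => hζ S fun s hs =>
    ⟨re_mul_ofReal_nonpos ha hs.1.le, mul_ne_zero ha0 (by exact_mod_cast hs.1.ne')⟩⟩

theorem exists_isRayLift_upper {a : ℂ} (ha : 0 < a.re) : ∃ ζ : ℝ → ℂ, ∀ S,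
    IsRayLift a S ζ ∧ ∀ s ∈ Ioo 0 S, (ζ s).im ∈ Ioo 0 (2 * π) := by
  obtain ⟨G, hG, hGD, hinv⟩ := exists_upper_inverse_potential
  obtain ⟨ζ, hζ⟩ := exists_isRayLift_of_inverse hG hGD hinv
    (fun ζ hζ => Or.inr (by rw [abs_of_pos hζ.1]; exact hζ.2.le))
    (fun ζ hζ => exp_ne_one_of_im_mem_Ioo hζ) a
  refine ⟨ζ, fun S => hζ S fun s hs => ?_⟩
  rw [mem_ofPred_eq, Complex.re_mul_ofReal]
  exact mul_pos ha hs.1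

theorem IsRayLift.conj {a : ℂ} {S : ℝ} {ζ : ℝ → ℂ} (h : IsRayLift a S ζ) :
    IsRayLift (conj a) S fun s => conj (ζ s) where
  zero := by simp [h.zero]
  continuousOn := Complex.continuous_conj.comp_continuousOn h.continuousOn
  potential_eq s hs := by simp [potential_conj, h.potential_eq s hs]
  exp_ne_one s hs := by
    rw [Complex.exp_conj, Ne, map_eq_one_iff _ (starRingEnd ℂ).injective]
    exact h.exp_ne_one s hs

theorem exists_isRayLift_lower {a : ℂ} (ha : 0 < a.re) : ∃ ζ : ℝ → ℂ, ∀ S,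
    IsRayLift a S ζ ∧ ∀ s ∈ Ioo 0 S, (ζ s).im ∈ Ioo (-(2 * π)) 0 := by
  obtain ⟨ζ, hζ⟩ := exists_isRayLift_upper (a := conj a) (by simpa)
  refine ⟨fun s => conj (ζ s), fun S => ⟨by simpa using (hζ S).1.conj, fun s hs => ?_⟩⟩
  have him := (hζ S).2 s hs
  exact ⟨by simpa using him.2, by simpa using him.1⟩

theorem hasDerivAt_of_comp_eq {f : ℂ → ℂ} {f' g' : ℂ} {g ζ : ℝ → ℂ} {s : ℝ}
    (hf : HasStrictDerivAt f f' (ζ s)) (hf' : f' ≠ 0) (hζ : ContinuousAt ζ s)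
    (hg : HasDerivAt g g' s) (hfg : ∀ᶠ t in 𝓝 s, f (ζ t) = g t) : HasDerivAt ζ (g' / f') s := by
  have hinv := (hf.to_localInverse hf').hasDerivAt
  rw [hfg.self_of_nhds] at hinv
  refine ((hinv.scomp s hg).congr_of_eventuallyEq ?_).congr_deriv ?_
  · filter_upwards [hζ.eventually (hf.hasStrictFDerivAt_equiv hf').eventually_left_inverse, hfg]
      with t hleft ht
    rw [Function.comp_apply, ← ht]
    exact hleft.symm
  · rw [smul_eq_mul, div_eq_mul_inv]

theorem IsRayLift.potential_eq_of_pos {a : ℂ} {ζ : ℝ → ℂ} (h : ∀ S, IsRayLift a S ζ) {s : ℝ}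
    (hs : 0 < s) : potential (ζ s) = a * s :=
  (h (s + 1)).potential_eq s ⟨hs, lt_add_one s⟩

theorem IsRayLift.continuousOn_Ici {a : ℂ} {ζ : ℝ → ℂ} (h : ∀ S, IsRayLift a S ζ) :
    ContinuousOn ζ (Ici 0) := fun s hs =>
  ((h (s + 1)).continuousOn s ⟨hs, lt_add_one s⟩).mono_of_mem_nhdsWithin
    (inter_mem_nhdsWithin _ (Iio_mem_nhds (lt_add_one s)))

theorem IsRayLift.hasDerivAt {a : ℂ} {S s : ℝ} {ζ : ℝ → ℂ} (h : IsRayLift a S ζ)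
    (hs : s ∈ Ioo 0 S) : HasDerivAt ζ (a / (1 - Complex.exp (ζ s))) s := by
  have hnhds := Ioo_mem_nhds hs.1 hs.2
  have hray : HasDerivAt (fun t : ℝ => a * (t : ℂ)) a s := by
    simpa using (hasDerivAt_id s).ofReal_comp.const_mul a
  exact hasDerivAt_of_comp_eq (hasStrictDerivAt_potential _)
    (sub_ne_zero.2 (h.exp_ne_one s hs).symm)
    ((h.continuousOn.mono Ioo_subset_Ico_self).continuousAt hnhds) hray
    (eventually_of_mem hnhds h.potential_eq)

/-- The point `y` with logarithmic coordinate `ζ = log (1 - c y / 2)`. -/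
noncomputable def ofLog (c ζ : ℂ) : ℂ := 2 / c * (1 - Complex.exp ζ)

theorem continuous_ofLog (c : ℂ) : Continuous (ofLog c) := by unfold ofLog; fun_prop

theorem ofLog_zero (c : ℂ) : ofLog c 0 = 0 := by simp [ofLog]

theorem ofLog_eq_ofLog_iff {c : ℂ} (hc : c ≠ 0) {ζ ξ : ℂ} :
    ofLog c ζ = ofLog c ξ ↔ Complex.exp ζ = Complex.exp ξ := by
  rw [ofLog, ofLog, mul_right_inj' (div_ne_zero two_ne_zero hc), sub_right_inj]

theorem ofLog_eq_zero_iff {c : ℂ} (hc : c ≠ 0) {ζ : ℂ} : ofLog c ζ = 0 ↔ Complex.exp ζ = 1 := by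
  rw [← ofLog_zero c, ofLog_eq_ofLog_iff hc, Complex.exp_zero]

theorem ofLog_sub (c ζ : ℂ) : ofLog c ζ - 2 / c = -(2 / c) * Complex.exp ζ := by
  rw [ofLog]; ring

theorem ofLog_ne {c : ℂ} (hc : c ≠ 0) (ζ : ℂ) : ofLog c ζ ≠ 2 / c := by
  rw [← sub_ne_zero, ofLog_sub]
  simp [hc, Complex.exp_ne_zero]

theorem ofLog_ne_of_re {c : ℂ} (hc : c ≠ 0) {ζ ξ : ℂ} (hζ : 0 < ζ.re) (hξ : ξ.re < 0) :
    ofLog c ζ ≠ ofLog c ξ := fun h => by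
  have := congrArg norm ((ofLog_eq_ofLog_iff hc).1 h)
  rw [Complex.norm_exp, Complex.norm_exp, Real.exp_eq_exp] at this
  linarith

theorem IsRayLift.isReverseTrajectory {c : ℂ} (hc : c ≠ 0) {ζ : ℝ → ℂ} {S T : ℝ}
    (h : IsRayLift (c ^ 2 / 2) S ζ) (hS : 0 < S) (hT : T < S) :
    IsReverseTrajectory c T fun s => ofLog c (ζ s) where
  tendsto_zero := by
    have hcont := (h.continuousOn 0 ⟨le_rfl, hS⟩).mono Ioo_subset_Ico_self
    rw [ContinuousWithinAt, nhdsWithin_Ioo_eq_nhdsGT hS, h.zero] at hcont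
    simpa [ofLog_zero, Function.comp_def] using (continuous_ofLog c).continuousAt.tendsto.comp hcont
  ne_zero s hs := (ofLog_eq_zero_iff hc).not.2 (h.exp_ne_one s ⟨hs.1, hs.2.trans_lt hT⟩)
  hasDeriv s hs := by
    have hs' : s ∈ Ioo 0 S := ⟨hs.1, hs.2.trans_lt hT⟩
    have hne : 1 - Complex.exp (ζ s) ≠ 0 := sub_ne_zero.2 (h.exp_ne_one s hs').symm
    refine ((((h.hasDerivAt hs').cexp.const_sub 1).const_mul (2 / c)).congr_deriv
      ?_).hasDerivWithinAt
    rw [ofLog]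
    field_simp
    ring

theorem isBlowUpPair_top {c : ℂ} {γp γm : ℝ → ℂ} (hp : ∀ T, IsReverseTrajectory c T γp)
    (hm : ∀ T, IsReverseTrajectory c T γm) (hp0 : γp 0 = 0) (hm0 : γm 0 = 0)
    (hne : ∀ T > 0, γp T ≠ γm T) : IsBlowUpPair (linearDriver c) γp γm ⊤ :=
  isBlowUpPair_of_isReverseTrajectory hp (fun T _ => hm T) hp0 hm0
    (IsReverseTrajectory.continuousOn_Ici hm hm0) EReal.zero_lt_top (fun T hT _ => hne T hT)
    fun T hT => absurd (EReal.coe_lt_top T) hT.not_gt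

theorem isBlowUpPair_ofLog {c : ℂ} (hc : c ≠ 0) {ζp ζm : ℝ → ℂ}
    (hp : ∀ S, IsRayLift (c ^ 2 / 2) S ζp) (hm : ∀ S, IsRayLift (c ^ 2 / 2) S ζm)
    (hne : ∀ s > 0, ofLog c (ζp s) ≠ ofLog c (ζm s)) :
    IsBlowUpPair (linearDriver c) (fun s => ofLog c (ζp s)) (fun s => ofLog c (ζm s)) ⊤ := by
  have htraj : ∀ {ζ : ℝ → ℂ}, (∀ S, IsRayLift (c ^ 2 / 2) S ζ) →
      ∀ T, IsReverseTrajectory c T fun s => ofLog c (ζ s) := fun hζ T =>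
    (hζ (|T| + 1)).isReverseTrajectory hc (by positivity) (by linarith [le_abs_self T])
  exact isBlowUpPair_top (htraj hp) (htraj hm) (by simp [(hp 0).zero, ofLog_zero])
    (by simp [(hm 0).zero, ofLog_zero]) hne

theorem norm_potential_le {ζ : ℂ} (hre : -2 ≤ ζ.re) (him : |ζ.im| ≤ 2 * π) :
    ‖potential ζ‖ ≤ 2 * ‖1 - Complex.exp ζ‖ + (3 + 2 * π) := by
  have hsum : ‖potential ζ‖ ≤ ‖ζ‖ + ‖1 - Complex.exp ζ‖ := by
    rw [show potential ζ = ζ + (1 - Complex.exp ζ) by rw [potential]; ring]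
    exact norm_add_le _ _
  have hexp : Real.exp ζ.re ≤ 1 + ‖1 - Complex.exp ζ‖ := by
    have := norm_sub_norm_le (Complex.exp ζ) 1
    rw [Complex.norm_exp, norm_one, norm_sub_rev] at this
    linarith
  have hre' : |ζ.re| ≤ 2 + Real.exp ζ.re :=
    abs_le.2 ⟨by linarith [Real.exp_pos ζ.re], by linarith [Real.add_one_le_exp ζ.re]⟩
  linarith [Complex.norm_le_abs_re_add_abs_im ζ]

theorem tendsto_ofLog_cobounded {α : Type*} {l : Filter α} {c : ℂ} (hc : c ≠ 0) {ζ : α → ℂ}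
    (hpot : Tendsto (fun s => potential (ζ s)) l (Bornology.cobounded ℂ))
    (hζ : ∀ᶠ s in l, -2 ≤ (ζ s).re ∧ |(ζ s).im| ≤ 2 * π) :
    Tendsto (fun s => ofLog c (ζ s)) l (Bornology.cobounded ℂ) := by
  rw [← tendsto_norm_atTop_iff_cobounded] at hpot ⊢
  simp only [ofLog, norm_mul]
  refine Tendsto.const_mul_atTop (norm_pos_iff.2 (div_ne_zero two_ne_zero hc)) ?_
  refine tendsto_atTop_mono' l (hζ.mono fun s hs => ?_)
    ((tendsto_atTop_add_const_right l (-(3 + 2 * π)) hpot).atTop_div_const two_pos)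
  linarith [norm_potential_le hs.1 hs.2]

theorem IsRayLift.tendsto_potential {a : ℂ} (ha : a ≠ 0) {ζ : ℝ → ℂ}
    (h : ∀ S, IsRayLift a S ζ) :
    Tendsto (fun s => potential (ζ s)) atTop (Bornology.cobounded ℂ) := by
  rw [← tendsto_norm_atTop_iff_cobounded]
  refine (tendsto_id.const_mul_atTop (norm_pos_iff.2 ha)).congr'
    ((eventually_gt_atTop 0).mono fun s hs => ?_)
  simp only [id]
  rw [IsRayLift.potential_eq_of_pos h hs, norm_mul, Complex.norm_real,
    Real.norm_of_nonneg hs.le]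

theorem neg_two_le_re_of_potential_re_nonneg {ζ : ℂ} (h : 0 ≤ (potential ζ).re) :
    -2 ≤ ζ.re := by
  by_contra! hlt
  rw [potential_re] at h
  have hexp : Real.exp ζ.re ≤ 1 := Real.exp_le_one_iff.2 (by linarith)
  nlinarith [Real.neg_one_le_cos ζ.im, Real.exp_pos ζ.re]

theorem tendsto_ofLog_cobounded_of_re_pos {a c : ℂ} (hc : c ≠ 0) (ha : 0 < a.re) {ζ : ℝ → ℂ}
    (h : ∀ S, IsRayLift a S ζ) (him : ∀ s > 0, |(ζ s).im| ≤ 2 * π) :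
    Tendsto (fun s => ofLog c (ζ s)) atTop (Bornology.cobounded ℂ) := by
  have ha0 : a ≠ 0 := fun h0 => by simp [h0] at ha
  refine tendsto_ofLog_cobounded hc (IsRayLift.tendsto_potential ha0 h)
    ((eventually_gt_atTop 0).mono fun s hs => ⟨?_, him s hs⟩)
  refine neg_two_le_re_of_potential_re_nonneg ?_
  rw [IsRayLift.potential_eq_of_pos h hs, Complex.re_mul_ofReal]
  positivity

theorem tendsto_ofLog_cobounded_of_re_nonpos {a c : ℂ} (hc : c ≠ 0) (ha : a ≠ 0) {ζ : ℝ → ℂ}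
    (h : ∀ S, IsRayLift a S ζ ∧ ∀ s ∈ Ioo 0 S, 0 < (ζ s).re ∧ |(ζ s).im| < π) :
    Tendsto (fun s => ofLog c (ζ s)) atTop (Bornology.cobounded ℂ) := by
  refine tendsto_ofLog_cobounded hc (IsRayLift.tendsto_potential ha fun S => (h S).1)
    ((eventually_gt_atTop 0).mono fun s hs => ?_)
  have hs' := (h (s + 1)).2 s ⟨hs, lt_add_one s⟩
  constructor <;> linarith [hs'.1, hs'.2, Real.pi_pos]

theorem sq_half_re (c : ℂ) : (c ^ 2 / 2).re = (c.re ^ 2 - c.im ^ 2) / 2 := by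
  simp [sq]

theorem sq_half_im (c : ℂ) : (c ^ 2 / 2).im = c.re * c.im := by
  simp [sq]; ring

theorem isReverseTrajectory_mul_sqrt {b : ℂ} (hb : b ^ 2 = -4) (T : ℝ) :
    IsReverseTrajectory 0 T fun s => b * (√s : ℂ) := by
  have hb0 : b ≠ 0 := fun h => by simp [h] at hb
  refine ⟨?_, fun s hs => ?_, fun s hs => ?_⟩
  · have hcont : Continuous fun s : ℝ => b * (√s : ℂ) := by fun_prop
    simpa using (hcont.tendsto 0).mono_left nhdsWithin_le_nhds
  · exact mul_ne_zero hb0 (Complex.ofReal_ne_zero.2 (Real.sqrt_pos.2 hs.1).ne')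
  · have hsqrt : (√s : ℂ) ≠ 0 := Complex.ofReal_ne_zero.2 (Real.sqrt_pos.2 hs.1).ne'
    refine (((Real.hasDerivAt_sqrt hs.1.ne').ofReal_comp).const_mul b).congr_deriv ?_
      |>.hasDerivWithinAt
    push_cast
    field_simp
    linear_combination hb

theorem tendsto_mul_sqrt_cobounded {b : ℂ} (hb : b ≠ 0) :
    Tendsto (fun s : ℝ => b * (√s : ℂ)) atTop (Bornology.cobounded ℂ) := by
  rw [← tendsto_norm_atTop_iff_cobounded]
  refine (Real.tendsto_sqrt_atTop.const_mul_atTop (norm_pos_iff.2 hb)).congr fun s => ?_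
  rw [norm_mul, Complex.norm_real, Real.norm_of_nonneg (Real.sqrt_nonneg s)]

theorem exists_isBlowUpPair_zero : ∃ γp γm, IsBlowUpPair (linearDriver 0) γp γm ⊤ ∧
    Tendsto γp atTop (Bornology.cobounded ℂ) ∧ Tendsto γm atTop (Bornology.cobounded ℂ) := by
  have hb : (2 * Complex.I) ^ 2 = -4 := by rw [mul_pow, Complex.I_sq]; norm_num
  refine ⟨_, _, isBlowUpPair_top (isReverseTrajectory_mul_sqrt hb)
    (isReverseTrajectory_mul_sqrt ((neg_sq _).trans hb)) (by simp) (by simp) fun s hs h => ?_,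
    tendsto_mul_sqrt_cobounded (by simp), tendsto_mul_sqrt_cobounded (by simp)⟩
  have hsqrt : √s ≠ 0 := (Real.sqrt_pos.2 hs).ne'
  rw [neg_mul, self_eq_neg] at h
  simp [hsqrt] at h

theorem ofLog_ne_of_im {c ζ ξ : ℂ} (hc : c ≠ 0) (hpot : potential ζ = potential ξ)
    (hζ : 0 < ζ.im) (hξ : ξ.im < 0) : ofLog c ζ ≠ ofLog c ξ := fun h => by
  obtain ⟨n, rfl⟩ := Complex.exp_eq_exp_iff_exists_int.1 ((ofLog_eq_ofLog_iff hc).1 h)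
  rw [potential_add_int_mul, add_eq_left] at hpot
  rw [hpot, add_zero] at hζ
  exact hζ.not_gt hξ

theorem exists_isBlowUpPair_of_pos {c : ℂ} (h : 0 < c.re ^ 2 - c.im ^ 2) :
    ∃ γp γm, IsBlowUpPair (linearDriver c) γp γm ⊤ ∧
      Tendsto γp atTop (Bornology.cobounded ℂ) ∧ Tendsto γm atTop (Bornology.cobounded ℂ) := by
  have hc : c ≠ 0 := fun h0 => by simp [h0] at h
  have ha : 0 < (c ^ 2 / 2).re := by rw [sq_half_re]; linarith
  obtain ⟨ζp, hp⟩ := exists_isRayLift_upper ha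
  obtain ⟨ζm, hm⟩ := exists_isRayLift_lower ha
  have hmem : ∀ s : ℝ, 0 < s → s ∈ Ioo 0 (s + 1) := fun s hs => ⟨hs, lt_add_one s⟩
  have hp_im : ∀ s > 0, (ζp s).im ∈ Ioo 0 (2 * π) := fun s hs => (hp _).2 s (hmem s hs)
  have hm_im : ∀ s > 0, (ζm s).im ∈ Ioo (-(2 * π)) 0 := fun s hs => (hm _).2 s (hmem s hs)
  refine ⟨_, _, isBlowUpPair_ofLog hc (fun S => (hp S).1) (fun S => (hm S).1) fun s hs =>
      ofLog_ne_of_im hc ?_ (hp_im s hs).1 (hm_im s hs).2,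
    tendsto_ofLog_cobounded_of_re_pos hc ha (fun S => (hp S).1) fun s hs => ?_,
    tendsto_ofLog_cobounded_of_re_pos hc ha (fun S => (hm S).1) fun s hs => ?_⟩
  · rw [IsRayLift.potential_eq_of_pos (fun S => (hp S).1) hs,
      IsRayLift.potential_eq_of_pos (fun S => (hm S).1) hs]
  · exact abs_le.2 ⟨by linarith [(hp_im s hs).1, Real.pi_pos], (hp_im s hs).2.le⟩
  · exact abs_le.2 ⟨(hm_im s hs).1.le, by linarith [(hm_im s hs).2, Real.pi_pos]⟩

theorem re_le_of_potential_eq {a ζ : ℂ} {s : ℝ} (hpot : potential ζ = a * s) (hre : ζ.re < 0) :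
    ζ.re ≤ a.re * s := by
  have hpot_re := potential_re ζ
  rw [hpot, Complex.re_mul_ofReal] at hpot_re
  have hexp : Real.exp ζ.re ≤ 1 := Real.exp_le_one_iff.2 hre.le
  nlinarith [Real.exp_pos ζ.re, Real.cos_le_one ζ.im]

theorem abs_im_sub_le_of_potential_eq {a ζ : ℂ} {s : ℝ} (hpot : potential ζ = a * s)
    (hre : ζ.re < 0) : |ζ.im - a.im * s| ≤ 1 := by
  have hpot_im := potential_im ζ
  rw [hpot, Complex.im_mul_ofReal] at hpot_im
  rw [hpot_im, sub_sub_cancel, abs_mul, abs_of_pos (Real.exp_pos _)]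
  exact mul_le_one₀ (Real.exp_le_one_iff.2 hre.le) (abs_nonneg _) (Real.abs_sin_le_one _)

theorem tendsto_ofLog_of_re_neg {a : ℂ} (c : ℂ) (ha : a.re < 0) {ζ : ℝ → ℂ}
    (h : ∀ S, IsRayLift a S ζ) (hre : ∀ s > 0, (ζ s).re < 0) :
    Tendsto (fun s => ofLog c (ζ s)) atTop (𝓝 (2 / c)) := by
  have hre_bot : Tendsto (fun s => (ζ s).re) atTop atBot :=
    tendsto_atBot_mono' atTop ((eventually_gt_atTop 0).mono fun s hs =>
      re_le_of_potential_eq (IsRayLift.potential_eq_of_pos h hs) (hre s hs))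
      (tendsto_id.const_mul_atTop_of_neg ha)
  have hexp : Tendsto (fun s => Complex.exp (ζ s)) atTop (𝓝 0) :=
    Complex.tendsto_exp_comap_re_atBot.comp (tendsto_comap_iff.2 hre_bot)
  simpa [ofLog] using (hexp.const_sub 1).const_mul (2 / c)

theorem ofLog_sub_eq_norm_mul_exp (c ζ : ℂ) :
    ofLog c ζ - 2 / c = ‖ofLog c ζ - 2 / c‖ *
      Complex.exp (((-(2 / c)).arg + ζ.im : ℝ) * Complex.I) := by
  rw [ofLog_sub, norm_mul, Complex.norm_exp]
  conv_lhs => rw [← Complex.norm_mul_exp_arg_mul_I (-(2 / c)), ← Complex.re_add_im ζ]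
  push_cast
  rw [Complex.exp_add, add_mul, Complex.exp_add]
  ring

theorem windsInfinitely_ofLog {a : ℂ} (c : ℂ) (ha : a.im ≠ 0) {ζ : ℝ → ℂ}
    (h : ∀ S, IsRayLift a S ζ) (hre : ∀ s > 0, (ζ s).re < 0) :
    WindsInfinitely (fun t => ofLog c (ζ t)) (2 / c) := by
  have him : ∀ᶠ s in atTop, |(ζ s).im - a.im * s| ≤ 1 := (eventually_gt_atTop 0).mono fun s hs =>
    abs_im_sub_le_of_potential_eq (IsRayLift.potential_eq_of_pos h hs) (hre s hs)
  refine ⟨fun t => (-(2 / c)).arg + (ζ t).im, continuousOn_const.add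
    (Complex.continuous_im.comp_continuousOn (IsRayLift.continuousOn_Ici h)),
    fun t _ => ofLog_sub_eq_norm_mul_exp c (ζ t), ?_⟩
  rcases ha.lt_or_gt with ha | ha
  · refine Or.inr (tendsto_atBot_add_const_left _ _ (tendsto_atBot_mono' atTop
      (him.mono fun s hs => ?_)
      (tendsto_atBot_add_const_right _ 1 (tendsto_id.const_mul_atTop_of_neg ha))))
    exact sub_le_iff_le_add'.1 (abs_le.1 hs).2
  · refine Or.inl (tendsto_atTop_add_const_left _ _ (tendsto_atTop_mono' atTop
      (him.mono fun s hs => ?_)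
      (tendsto_atTop_add_const_right _ (-1) (tendsto_id.const_mul_atTop ha))))
    exact le_sub_iff_add_le'.1 (abs_le.1 hs).1

theorem ofLog_ofReal_mem_segment (c : ℂ) {x : ℝ} (hx : x ≤ 0) :
    ofLog c x ∈ segment ℝ 0 (2 / c) := by
  refine ⟨Real.exp x, 1 - Real.exp x, (Real.exp_pos x).le,
    sub_nonneg.2 (Real.exp_le_one_iff.2 hx), add_sub_cancel _ _, ?_⟩
  rw [smul_zero, zero_add, Complex.real_smul, ofLog]
  push_cast
  ring

theorem ofLog_mem_segment {a : ℂ} (c : ℂ) (ha : a.im = 0) {ζ : ℝ → ℂ}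
    (h : ∀ S, IsRayLift a S ζ) (hre : ∀ s > 0, (ζ s).re < 0) {t : ℝ} (ht : 0 ≤ t) :
    ofLog c (ζ t) ∈ segment ℝ 0 (2 / c) := by
  rcases ht.eq_or_lt with rfl | ht
  · rw [(h 0).zero, ofLog_zero]
    exact left_mem_segment ℝ _ _
  have hconj : starRingEnd ℂ (ζ t) = ζ t := by
    refine injOn_potential_re_neg ?_ (hre t ht) ?_
    · simpa using hre t ht
    · rw [potential_conj, IsRayLift.potential_eq_of_pos h ht, map_mul, Complex.conj_ofReal,
        Complex.conj_eq_iff_im.2 ha]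
  rw [← Complex.conj_eq_iff_re.1 hconj]
  exact ofLog_ofReal_mem_segment c (hre t ht).le

theorem exists_isBlowUpPair_of_neg {c : ℂ} (h : c.re ^ 2 - c.im ^ 2 < 0) :
    ∃ γp γm, IsBlowUpPair (linearDriver c) γp γm ⊤ ∧
      Tendsto γp atTop (Bornology.cobounded ℂ) ∧ Tendsto γm atTop (𝓝 (2 / c)) ∧
      (∀ s, γp s ≠ 2 / c ∧ γm s ≠ 2 / c) ∧ (c.re ≠ 0 → WindsInfinitely γm (2 / c)) ∧
      (c.re = 0 → ∀ t ≥ 0, γm t ∈ segment ℝ 0 (2 / c)) := by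
  have hc : c ≠ 0 := fun h0 => by simp [h0] at h
  have ha : (c ^ 2 / 2).re < 0 := by rw [sq_half_re]; linarith
  have ha0 : c ^ 2 / 2 ≠ 0 := by simpa using hc
  have hcrit : ∀ s : ℝ, 0 < s → ∀ n : ℤ, c ^ 2 / 2 * s ≠ n * (2 * π * Complex.I) :=
    fun s hs n heq => by
      have hre := congrArg Complex.re heq
      rw [Complex.re_mul_ofReal] at hre
      exact (mul_neg_of_neg_of_pos ha hs).ne (hre.trans (by simp))
  obtain ⟨ζp, hp⟩ := exists_isRayLift_right ha.le ha0
  obtain ⟨ζm, hm⟩ := exists_isRayLift_left ha.le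
  have hlift : ∀ S, IsRayLift (c ^ 2 / 2) S ζm := fun S => (hm S fun s hs => hcrit s hs.1).1
  have hre : ∀ s > 0, (ζm s).re < 0 := fun s hs =>
    (hm (s + 1) fun s hs => hcrit s hs.1).2 s ⟨hs, lt_add_one s⟩
  refine ⟨_, _, isBlowUpPair_ofLog hc (fun S => (hp S).1) hlift fun s hs =>
      ofLog_ne_of_re hc ((hp (s + 1)).2 s ⟨hs, lt_add_one s⟩).1 (hre s hs),
    tendsto_ofLog_cobounded_of_re_nonpos hc ha0 hp, tendsto_ofLog_of_re_neg c ha hlift hre,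
    fun s => ⟨ofLog_ne hc _, ofLog_ne hc _⟩, fun hcre => ?_,
    fun hcre t ht => ofLog_mem_segment c (by rw [sq_half_im, hcre, zero_mul]) hlift hre ht⟩
  refine windsInfinitely_ofLog c ?_ hlift hre
  rw [sq_half_im]
  exact mul_ne_zero hcre fun h0 => by rw [h0] at h; nlinarith

/-- A continuous function `φ` whose sublevel sets up to level `1` are star-shaped about `p`, with
bounded open unit sublevel set: a means to describe a curve around `p`, the level set `φ = 1`,
together with its inside `φ < 1` and its outside `1 < φ`. -/
structure IsStarGauge (φ : ℂ → ℝ) (p : ℂ) : Prop where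
  continuous : Continuous φ
  lt_one : φ p < 1
  le_of_le_one : ∀ z, φ z ≤ 1 → ∀ t ∈ Icc (0 : ℝ) 1, φ (p + t • (z - p)) ≤ φ z
  isBounded : Bornology.IsBounded {z | φ z < 1}

theorem lt_of_isPreconnected_of_forall_ne {X : Type*} [TopologicalSpace X] {A : Set X} {φ : X → ℝ}
    {r : ℝ} (hA : IsPreconnected A) (hφ : ContinuousOn φ A) (hne : ∀ x ∈ A, φ x ≠ r) {x y : X}
    (hx : x ∈ A) (hxr : φ x < r) (hy : y ∈ A) : φ y < r := by
  by_contra! hyr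
  obtain ⟨z, hz, hzr⟩ := hA.intermediate_value hx hy hφ ⟨hxr.le, hyr⟩
  exact hne z hz hzr

namespace IsStarGauge

variable {φ : ℂ → ℝ} {p z : ℂ} {F : Set ℂ}

theorem isOpen (h : IsStarGauge φ p) : IsOpen {z | φ z < 1} :=
  isOpen_lt h.continuous continuous_const

theorem isConnected (h : IsStarGauge φ p) : IsConnected {z | φ z < 1} := by
  refine (StarConvex.isPathConnected (a := p) (fun z hz a b ha hb hab => ?_) h.lt_one).isConnected
  have hcomb : a • p + b • z = p + b • (z - p) := by
    rw [← sub_eq_iff_eq_add.2 hab.symm, sub_smul, one_smul, smul_sub]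
    abel
  rw [hcomb]
  exact (h.le_of_le_one z (le_of_lt hz) b ⟨hb, by linarith⟩).trans_lt hz

theorem connectedComponentIn_subset (h : IsStarGauge φ p) (hF : ∀ w ∈ F, φ w ≠ 1)
    (hzF : z ∈ F) (hz : φ z < 1) : connectedComponentIn F z ⊆ {w | φ w < 1} := fun _ hw =>
  lt_of_isPreconnected_of_forall_ne isPreconnected_connectedComponentIn h.continuous.continuousOn
    (fun w hw => hF w (_root_.connectedComponentIn_subset F z hw))
    (mem_connectedComponentIn hzF) hz hw

theorem connectedComponentIn_eq (h : IsStarGauge φ p) (hF : ∀ w ∈ F, φ w ≠ 1)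
    (hFφ : {w | φ w < 1} ⊆ F) (hz : φ z < 1) : connectedComponentIn F z = {w | φ w < 1} :=
  (h.connectedComponentIn_subset hF (hFφ hz) hz).antisymm
    (h.isConnected.isPreconnected.subset_connectedComponentIn hz hFφ)

theorem one_lt_of_one_lt (h : IsStarGauge φ p) (hz : 1 < φ z) {t : ℝ} (ht : 1 ≤ t) :
    1 < φ (p + t • (z - p)) := by
  by_contra! hle
  have hstar := h.le_of_le_one _ hle t⁻¹ ⟨by positivity, inv_le_one_of_one_le₀ ht⟩
  rw [add_sub_cancel_left, inv_smul_smul₀ (by positivity), add_sub_cancel] at hstar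
  linarith

theorem not_isBounded_of_one_lt (h : IsStarGauge φ p) (hz : 1 < φ z) :
    ¬ Bornology.IsBounded (connectedComponentIn {w | φ w ≠ 1} z) := by
  set ray : ℝ → ℂ := fun t => p + t • (z - p)
  have hzp : z - p ≠ 0 := fun h0 => by
    have := h.lt_one
    rw [← sub_eq_zero.1 h0] at this
    exact this.not_gt hz
  have hsub : ray '' Ici 1 ⊆ connectedComponentIn {w | φ w ≠ 1} z :=
    (isPreconnected_Ici.image _ (by fun_prop)).subset_connectedComponentIn
      ⟨1, self_mem_Ici, by simp [ray]⟩
      (image_subset_iff.2 fun t ht => (h.one_lt_of_one_lt hz ht).ne')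
  have hray : Tendsto ray atTop (Bornology.cobounded ℂ) := by
    rw [← tendsto_norm_atTop_iff_cobounded]
    refine tendsto_atTop_mono (fun t => ?_) (tendsto_atTop_add_const_right _ (-‖p‖)
      (tendsto_id.atTop_mul_const (norm_pos_iff.2 hzp)))
    have hnorm := norm_sub_norm_le (t • (z - p)) (-p)
    rw [norm_smul, norm_neg, sub_neg_eq_add, add_comm (t • _)] at hnorm
    have habs := mul_le_mul_of_nonneg_right (Real.le_norm_self t) (norm_nonneg (z - p))
    exact le_trans (by simpa [sub_eq_add_neg] using habs) hnorm
  intro hb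
  have hev := hray.eventually ((Bornology.isBounded_def.1 (hb.subset hsub)))
  obtain ⟨t, ht, ht1⟩ := (hev.and (eventually_ge_atTop 1)).exists
  exact ht (mem_image_of_mem _ ht1)

theorem interiorOf_eq (h : IsStarGauge φ p) : interiorOf {z | φ z = 1} = {z | φ z < 1} := by
  refine Subset.antisymm ?_ fun z hz => ⟨hz.ne, ?_⟩
  · rintro z ⟨hz, hb⟩
    exact (lt_or_gt_of_ne hz).resolve_right fun hlt => h.not_isBounded_of_one_lt hlt hb
  · exact h.isBounded.subset (h.connectedComponentIn_subset (fun _ hw => hw) hz.ne hz)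

end IsStarGauge

section ClosedPair

variable {lam γp γm : ℝ → ℂ} {S : EReal} {T : ℝ}

theorem image_twoSided_Icc_neg (h0 : γp 0 = γm 0) :
    twoSided γp γm '' Icc (-T) 0 = γm '' Icc 0 T := by
  have hIcc : Icc (-T) 0 = Neg.neg '' Icc 0 T := by simp
  rw [hIcc, image_image]
  exact image_congr fun t ht => twoSided_neg h0 ht.1

theorem image_twoSided_Iic (h0 : γp 0 = γm 0) : twoSided γp γm '' Iic 0 = γm '' Ici 0 := by
  have hIic : Iic (0 : ℝ) = Neg.neg '' Ici 0 := by simp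
  rw [hIic, image_image]
  exact image_congr fun t ht => twoSided_neg h0 ht

theorem image_twoSided_Ici : twoSided γp γm '' Ici 0 = γp '' Ici 0 :=
  image_congr fun _ ht => twoSided_of_nonneg ht

namespace IsBlowUpPair

theorem disjoint_leftHull (h : IsBlowUpPair lam γp γm T) (hlam : ContinuousOn lam (Ici 0))
    (hT : 0 < T) {φ : ℂ → ℝ} {r : ℝ} (hφp : ∀ t ≥ 0, r ≤ φ (γp t))
    (hφm : ∀ t ∈ Icc 0 T, r ≤ φ (γm t)) (t : ℝ) : Disjoint {z | φ z < r} (leftHull lam t) := by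
  rw [Set.disjoint_right]
  intro z hz
  obtain ⟨τ, -, hzτ⟩ := (mem_leftHull_iff hlam).1 hz
  change ¬φ z < r
  rw [not_lt]
  rcases h.eq_or_eq_of_blowsUpAt hzτ with rfl | rfl
  · exact hφp τ hzτ.nonneg
  · rcases le_total τ T with hτT | hTτ
    · exact hφm τ ⟨hzτ.nonneg, hτT⟩
    · rw [h.rests τ (EReal.coe_le_coe_iff.2 hTτ), ← h.neg_zero]
      exact hφm 0 ⟨le_rfl, hT.le⟩

theorem image_inter_image (h : IsBlowUpPair lam γp γm S) (hlam : ContinuousOn lam (Ici 0)) :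
    γp '' Ici 0 ∩ γm '' Ici 0 = {lam 0} := by
  refine Subset.antisymm ?_ (singleton_subset_iff.2
    ⟨⟨0, self_mem_Ici, h.pos_zero⟩, ⟨0, self_mem_Ici, h.neg_zero⟩⟩)
  rintro _ ⟨⟨s, hs, rfl⟩, t, ht, hst⟩
  rw [mem_singleton_iff, h.eq_zero_of_pos_eq_neg hlam hs ht hst.symm, h.pos_zero]

theorem isJordanCurveOn (h : IsBlowUpPair lam γp γm T) (hlam : ContinuousOn lam (Ici 0))
    (hT : 0 < T) : IsJordanCurveOn (twoSided γp γm) (-T) 0 (lam 0) where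
  lt := neg_lt_zero.2 hT
  continuousOn := (h.creates hlam).continuous.continuousOn
  left := (twoSided_neg_of_pos hT).trans (h.rests T le_rfl)
  right := (h.creates hlam).start
  injOn s hs t ht hst := by
    rw [← neg_neg s, ← neg_neg t, twoSided_neg h.pos_zero_eq_neg_zero (neg_nonneg.2 hs.2),
      twoSided_neg h.pos_zero_eq_neg_zero (neg_nonneg.2 ht.2)] at hst
    exact neg_injective (h.neg_injOn hlam
      ⟨neg_nonneg.2 hs.2, EReal.coe_lt_coe_iff.2 (neg_lt.1 hs.1)⟩
      ⟨neg_nonneg.2 ht.2, EReal.coe_lt_coe_iff.2 (neg_lt.1 ht.1)⟩ hst)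

theorem isExoticCurve (h : IsBlowUpPair lam γp γm T) (hlam : ContinuousOn lam (Ici 0))
    (hlam0 : lam 0 = 0) (hT : 0 < T) (hγp : Tendsto γp atTop (Bornology.cobounded ℂ))
    {φ : ℂ → ℝ} {p : ℂ} (hφ : IsStarGauge φ p) (hφp : ∀ t ≥ 0, 1 ≤ φ (γp t))
    (hφm : γm '' Icc 0 T = {z | φ z = 1}) : IsExoticCurve lam (twoSided γp γm) T := by
  have h0 := h.pos_zero_eq_neg_zero
  have hdisj : ∀ t, Disjoint {z | φ z < 1} (leftHull lam t) :=
    h.disjoint_leftHull hlam hT hφp fun t ht => (hφm.subset (mem_image_of_mem γm ht)).ge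
  have hcomponent : ∀ t ≥ T, ∀ z ∈ {z | φ z < 1},
      connectedComponentIn (leftHull lam t)ᶜ z = {z | φ z < 1} := fun t ht z hz => by
    refine hφ.connectedComponentIn_eq (fun w hw hw1 => hw ?_) (hdisj t).subset_compl_right hz
    obtain ⟨s, hs, rfl⟩ := hφm.superset hw1
    rw [(h.creates hlam).hull t (hT.le.trans ht)]
    exact ⟨-s, ⟨by linarith [hs.2], by linarith [hs.1]⟩, twoSided_neg h0 hs.1⟩
  have hinterior : interiorOf (twoSided γp γm '' Icc (-T) 0) = {z | φ z < 1} := by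
    rw [image_twoSided_Icc_neg h0, hφm, hφ.interiorOf_eq]
  constructor <;> try rw [hinterior]
  case creates => exact h.creates hlam
  case pos_injOn => exact (h.pos_injOn hlam).congr fun t ht => (twoSided_of_nonneg ht).symm
  case tendsto_pos =>
    exact hγp.congr' ((eventually_ge_atTop 0).mono fun t ht => (twoSided_of_nonneg ht).symm)
  case jordan => exact hlam0 ▸ h.isJordanCurveOn hlam hT
  case stops =>
    intro s hs
    rw [← neg_neg s, twoSided_neg h0 (by linarith),
      h.rests _ (EReal.coe_le_coe_iff.2 (le_neg.2 hs)), hlam0]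
  case inter =>
    rw [image_twoSided_Ici, image_twoSided_Iic h0, h.image_inter_image hlam, hlam0]
  case interior_open => exact hφ.isOpen
  case interior_connected => exact hφ.isConnected
  case interior_bounded => exact hφ.isBounded
  case interior_area => exact hφ.isOpen.measure_pos volume hφ.isConnected.nonempty
  case interior_disjoint => exact fun t _ => hdisj t
  case interior_component => exact hcomponent

end IsBlowUpPair

end ClosedPair

/-- A gauge of the loop traced by `q = exp ζ` when `potential ζ` runs through the imaginary axis and
`Re ζ ≤ 0`: the loop is its level set `1`. -/
noncomputable def loopGauge (q : ℂ) : ℝ := max ‖q‖ (‖q‖ * Real.exp (1 - q.re))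

theorem continuous_loopGauge : Continuous loopGauge := by unfold loopGauge; fun_prop

theorem loopGauge_zero : loopGauge 0 = 0 := by simp [loopGauge]

theorem loopGauge_exp (ζ : ℂ) :
    loopGauge (Complex.exp ζ) = Real.exp (max ζ.re (potential ζ).re) := by
  have hpot : (potential ζ).re = ζ.re + (1 - (Complex.exp ζ).re) := by
    simp only [potential, Complex.sub_re, Complex.add_re, Complex.one_re]
    ring
  rw [loopGauge, Complex.norm_exp, ← Real.exp_add, ← hpot, Real.exp_monotone.map_max]

theorem one_le_loopGauge_exp {ζ : ℂ} (h : 0 ≤ (potential ζ).re) :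
    1 ≤ loopGauge (Complex.exp ζ) := by
  rw [loopGauge_exp, Real.one_le_exp_iff]
  exact le_max_of_le_right h

theorem loopGauge_exp_eq_one_iff {ζ : ℂ} :
    loopGauge (Complex.exp ζ) = 1 ↔ ζ.re ≤ 0 ∧ (potential ζ).re = 0 := by
  rw [loopGauge_exp, Real.exp_eq_one_iff]
  refine ⟨fun h => ?_, fun h => h.2.symm ▸ max_eq_right h.1⟩
  have hre : ζ.re ≤ 0 := (le_max_left _ _).trans_eq h
  have hpot : (potential ζ).re ≤ 0 := (le_max_right _ _).trans_eq h
  refine ⟨hre, hpot.antisymm ?_⟩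
  rcases max_choice ζ.re (potential ζ).re with hmax | hmax
  · have hre0 : ζ.re = 0 := hmax.symm.trans h
    rw [potential_re, hre0, Real.exp_zero]
    linarith [Real.cos_le_one ζ.im]
  · exact (hmax.symm.trans h).ge

theorem loopGauge_smul_le {q : ℂ} (hq : q.re ≤ 1) {t : ℝ} (ht : t ∈ Icc (0 : ℝ) 1) :
    loopGauge (t • q) ≤ loopGauge q := by
  have hnorm : ‖t • q‖ = t * ‖q‖ := by rw [norm_smul, Real.norm_of_nonneg ht.1]
  have hle : t ≤ Real.exp ((t - 1) * q.re) :=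
    calc t = t - 1 + 1 := by ring
      _ ≤ Real.exp (t - 1) := Real.add_one_le_exp _
      _ ≤ Real.exp ((t - 1) * q.re) := Real.exp_le_exp.2 (by nlinarith [ht.2])
  refine max_le_max ?_ ?_
  · rw [hnorm]
    exact mul_le_of_le_one_left (norm_nonneg q) ht.2
  · calc ‖t • q‖ * Real.exp (1 - (t • q).re)
        = t * (‖q‖ * Real.exp (1 - t * q.re)) := by rw [hnorm, Complex.smul_re, smul_eq_mul]; ring
      _ ≤ Real.exp ((t - 1) * q.re) * (‖q‖ * Real.exp (1 - t * q.re)) := by gcongr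
      _ = ‖q‖ * Real.exp (1 - q.re) := by
        rw [mul_left_comm, ← Real.exp_add]
        ring_nf

theorem isStarGauge_loopGauge {c : ℂ} (hc : c ≠ 0) :
    IsStarGauge (fun z => loopGauge (1 - c * z / 2)) (2 / c) where
  continuous := continuous_loopGauge.comp (by fun_prop)
  lt_one := by
    have hcenter : 1 - c * (2 / c) / 2 = 0 := by field_simp; ring
    simp only [hcenter, loopGauge_zero, zero_lt_one]
  le_of_le_one z hz t ht := by
    have hsmul : 1 - c * (2 / c + t • (z - 2 / c)) / 2 = t • (1 - c * z / 2) := by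
      simp only [Complex.real_smul]
      field_simp
      ring
    simp only [hsmul]
    exact loopGauge_smul_le ((Complex.re_le_norm _).trans ((le_max_left _ _).trans hz)) ht
  isBounded := by
    refine Metric.isBounded_ball.subset fun z (hz : loopGauge (1 - c * z / 2) < 1) =>
      mem_ball_iff_norm.2 (?_ : ‖z - 2 / c‖ < ‖2 / c‖)
    have hz' : z - 2 / c = -(2 / c) * (1 - c * z / 2) := by field_simp; ring
    rw [hz', norm_mul, norm_neg]
    exact mul_lt_of_lt_one_right (norm_pos_iff.2 (div_ne_zero two_ne_zero hc))
      ((le_max_left _ _).trans_lt hz)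

theorem one_sub_mul_ofLog {c : ℂ} (hc : c ≠ 0) (ζ : ℂ) :
    1 - c * ofLog c ζ / 2 = Complex.exp ζ := by
  rw [ofLog]; field_simp; ring

theorem eq_ofLog_iff {c : ℂ} (hc : c ≠ 0) {z ζ : ℂ} :
    z = ofLog c ζ ↔ Complex.exp ζ = 1 - c * z / 2 := by
  refine ⟨fun h => h ▸ (one_sub_mul_ofLog hc ζ).symm, fun h => ?_⟩
  rw [ofLog, h]; field_simp; ring

theorem mul_ne_int_mul_of_mem_Ioo {a : ℂ} {S s : ℝ} (haS : ‖a‖ * S = 2 * π) (hs : s ∈ Ioo 0 S)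
    (n : ℤ) : a * s ≠ n * (2 * π * Complex.I) := fun h => by
  have hpi := Real.two_pi_pos
  have ha : 0 < ‖a‖ := pos_of_mul_pos_left (haS ▸ hpi) (hs.1.trans hs.2).le
  have hnorm : ‖a‖ * s = |(n : ℝ)| * (2 * π) := by
    simpa [abs_of_pos hs.1, abs_of_pos Real.pi_pos] using congrArg norm h
  have hlt : |(n : ℝ)| * (2 * π) < 1 * (2 * π) := by
    rw [← hnorm, one_mul, ← haS]
    exact mul_lt_mul_of_pos_left hs.2 ha
  have hpos : 0 < |(n : ℝ)| * (2 * π) := hnorm ▸ mul_pos ha hs.1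
  have hn1 : |n| < 1 := by exact_mod_cast lt_of_mul_lt_mul_right hlt hpi.le
  rw [Int.abs_lt_one_iff.1 hn1] at hpos
  simp at hpos

theorem exists_mul_eq_int_mul {a : ℂ} (ha : a.re = 0) {S : ℝ} (haS : ‖a‖ * S = 2 * π) :
    ∃ n : ℤ, a * S = n * (2 * π * Complex.I) := by
  have haI : a = a.im * Complex.I := by apply Complex.ext <;> simp [ha]
  rw [← Complex.abs_im_eq_norm.2 ha] at haS
  rcases abs_choice a.im with him | him <;> rw [him] at haS
  · refine ⟨1, ?_⟩
    rw [haI, mul_right_comm, ← Complex.ofReal_mul, haS]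
    push_cast
    ring
  · refine ⟨-1, ?_⟩
    rw [haI, mul_right_comm, ← Complex.ofReal_mul, ← neg_neg (a.im * S), ← neg_mul, haS]
    push_cast
    ring

theorem IsRayLift.tendsto_of_re_nonpos {a : ℂ} {S : ℝ} {ζ : ℝ → ℂ} (h : IsRayLift a S ζ)
    (hS : 0 < S) (hre : ∀ s ∈ Ioo 0 S, (ζ s).re ≤ 0) {n : ℤ}
    (hn : a * S = n * (2 * π * Complex.I)) :
    Tendsto ζ (𝓝[<] S) (𝓝 (n * (2 * π * Complex.I))) := by
  have hev : ∀ᶠ s in 𝓝[<] S, s ∈ Ioo 0 S := Ioo_mem_nhdsLT hS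
  have hperiod : potential (n * (2 * π * Complex.I)) = n * (2 * π * Complex.I) := by
    rw [← zero_add ((n : ℂ) * _), potential_add_int_mul, potential_zero]
  refine tendsto_of_tendsto_potential (K := {ζ | ζ.re ≤ 0})
    (isClosed_le Complex.continuous_re continuous_const) (fun ζ hζ => Or.inl hζ) (hev.mono hre) ?_
    fun q hq hqpot => ?_
  · rw [hperiod, ← hn]
    have hcont : Continuous fun s : ℝ => a * (s : ℂ) := by fun_prop
    exact (hcont.continuousAt.mono_left nhdsWithin_le_nhds).congr'
      (hev.mono fun s hs => (h.potential_eq s hs).symm)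
  · have hshift := potential_add_int_mul q (-n)
    rw [hqpot, hperiod, Int.cast_neg, neg_mul, add_neg_cancel] at hshift
    exact eq_neg_of_add_eq_zero_left (eq_zero_of_potential_eq_zero (Or.inl (by simpa using hq))
      hshift) |>.trans (neg_neg _)

theorem continuousOn_Ici_ite {X : Type*} [TopologicalSpace X] {f : ℝ → X} {a b : ℝ} {x : X}
    (hf : ContinuousOn f (Ico a b)) (hb : Tendsto f (𝓝[<] b) (𝓝 x)) :
    ContinuousOn (fun s => if s < b then f s else x) (Ici a) := by
  intro s hs
  rcases lt_trichotomy s b with h | rfl | h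
  · refine ((hf s ⟨hs, h⟩).mono_of_mem_nhdsWithin
      (inter_mem_nhdsWithin _ (Iio_mem_nhds h))).congr_of_eventuallyEq ?_ (if_pos h)
    filter_upwards [mem_nhdsWithin_of_mem_nhds (Iio_mem_nhds h)] with t ht using if_pos ht
  · refine ContinuousAt.continuousWithinAt (continuousAt_iff_continuous_left'_right'.2 ⟨?_, ?_⟩)
    · rw [ContinuousWithinAt, if_neg (lt_irrefl s)]
      exact hb.congr' (eventually_mem_nhdsWithin.mono fun t ht => (if_pos ht).symm)
    · rw [ContinuousWithinAt, if_neg (lt_irrefl s)]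
      exact tendsto_const_nhds.congr'
        (eventually_mem_nhdsWithin.mono fun t ht => (if_neg (not_lt_of_gt ht)).symm)
  · refine ((continuousAt_const (y := x)).congr ?_).continuousWithinAt
    filter_upwards [Ioi_mem_nhds h] with t ht using (if_neg (not_lt_of_gt ht)).symm

theorem re_neg_of_potential_re_nonpos {ξ : ℂ} (hre : ξ.re ≤ 0) (hpot : (potential ξ).re ≤ 0)
    (hexp : Complex.exp ξ ≠ 1) : ξ.re < 0 := by
  refine hre.lt_of_ne fun h0 => hexp ?_
  obtain ⟨n, hn⟩ := (Real.cos_eq_one_iff _).1 (cos_im_eq_one_of_potential_re_nonpos h0 hpot)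
  exact Complex.exp_eq_one_iff.2 ⟨n, by apply Complex.ext <;> simp [h0, ← hn]⟩

section RayLift

variable {a : ℂ} {S : ℝ} {ζ : ℝ → ℂ} {n : ℤ}

theorem IsRayLift.exists_exp_eq (h : IsRayLift a S ζ) (hS : 0 < S)
    (hre : ∀ s ∈ Ioo 0 S, (ζ s).re < 0) (hn : a * S = n * (2 * π * Complex.I)) {ξ : ℂ}
    (hξ : ξ.re < 0) {x : ℝ} (hx : potential ξ = a * x) :
    ∃ s ∈ Ico 0 S, Complex.exp (ζ s) = Complex.exp ξ := by
  obtain ⟨m, hm, -⟩ := existsUnique_add_zsmul_mem_Ico hS x 0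
  rw [zero_add] at hm
  set s := x + m • S
  set ξ' := ξ + (m * n : ℤ) * (2 * π * Complex.I)
  have hξ' : ξ'.re < 0 := by simpa [ξ'] using hξ
  have hpot : potential ξ' = a * s := by
    rw [potential_add_int_mul, hx]
    simp only [s, zsmul_eq_mul]
    push_cast
    linear_combination -(m : ℂ) * hn
  have hs0 : s ≠ 0 := fun hs0 => by
    rw [hs0, Complex.ofReal_zero, mul_zero] at hpot
    rw [eq_zero_of_potential_eq_zero (Or.inl hξ'.le) hpot] at hξ'
    exact lt_irrefl _ hξ'
  have hs : s ∈ Ioo 0 S := ⟨hm.1.lt_of_ne' hs0, hm.2⟩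
  refine ⟨s, hm, Complex.exp_eq_exp_iff_exists_int.2 ⟨m * n, ?_⟩⟩
  exact injOn_potential_re_neg (hre s hs) hξ' ((h.potential_eq s hs).trans hpot.symm)

theorem IsRayLift.image_exp_Ico (h : IsRayLift a S ζ) (ha : a.re = 0) (hS : 0 < S)
    (hre : ∀ s ∈ Ioo 0 S, (ζ s).re < 0) (hn : a * S = n * (2 * π * Complex.I)) (ha0 : a ≠ 0) :
    (fun s => Complex.exp (ζ s)) '' Ico 0 S = {q | loopGauge q = 1} := by
  refine Subset.antisymm (image_subset_iff.2 fun s hs => loopGauge_exp_eq_one_iff.2 ?_)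
    fun q (hq : loopGauge q = 1) => ?_
  · rcases hs.1.eq_or_lt with rfl | hs0
    · simp [h.zero, potential_zero]
    · exact ⟨(hre s ⟨hs0, hs.2⟩).le, by simp [h.potential_eq s ⟨hs0, hs.2⟩, ha]⟩
  · have hq0 : q ≠ 0 := fun h0 => by simp [h0, loopGauge_zero] at hq
    obtain ⟨ξ, rfl⟩ : ∃ ξ, Complex.exp ξ = q := ⟨_, Complex.exp_log hq0⟩
    obtain ⟨hξ, hpot⟩ := loopGauge_exp_eq_one_iff.1 hq
    by_cases hexp : Complex.exp ξ = 1
    · exact ⟨0, ⟨le_rfl, hS⟩, by simp [h.zero, hexp]⟩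
    · have him : a.im ≠ 0 := fun him => ha0 (Complex.ext ha him)
      refine h.exists_exp_eq hS hre hn (re_neg_of_potential_re_nonpos hξ hpot.le hexp)
        (x := (potential ξ).im / a.im) ?_
      apply Complex.ext
      · rw [Complex.re_mul_ofReal, ha, zero_mul, hpot]
      · rw [Complex.im_mul_ofReal, mul_div_cancel₀ _ him]

end RayLift

/-- The curve `s ↦ ofLog c (ζ s)` up to time `S`, resting at `0` from then on. -/
noncomputable def loop (c : ℂ) (S : ℝ) (ζ : ℝ → ℂ) (s : ℝ) : ℂ :=
  if s < S then ofLog c (ζ s) else 0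

theorem loop_of_lt (c : ℂ) {S s : ℝ} (ζ : ℝ → ℂ) (hs : s < S) : loop c S ζ s = ofLog c (ζ s) :=
  if_pos hs

theorem loop_of_le (c : ℂ) {S s : ℝ} (ζ : ℝ → ℂ) (hs : S ≤ s) : loop c S ζ s = 0 :=
  if_neg hs.not_gt

section Loop

variable {c : ℂ} {S : ℝ} {ζ : ℝ → ℂ} {n : ℤ}

theorem loop_zero (h : IsRayLift (c ^ 2 / 2) S ζ) (hS : 0 < S) : loop c S ζ 0 = 0 := by
  rw [loop_of_lt c ζ hS, h.zero, ofLog_zero]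

theorem continuousOn_loop (h : IsRayLift (c ^ 2 / 2) S ζ) (hS : 0 < S)
    (hre : ∀ s ∈ Ioo 0 S, (ζ s).re < 0) (hn : c ^ 2 / 2 * S = n * (2 * π * Complex.I)) :
    ContinuousOn (loop c S ζ) (Ici 0) := by
  refine continuousOn_Ici_ite ((continuous_ofLog c).comp_continuousOn h.continuousOn) ?_
  have hlim := h.tendsto_of_re_nonpos hS (fun s hs => (hre s hs).le) hn
  have hend : ofLog c (n * (2 * π * Complex.I)) = 0 := by
    rw [ofLog, Complex.exp_int_mul_two_pi_mul_I, sub_self, mul_zero]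
  exact hend ▸ ((continuous_ofLog c).tendsto _).comp hlim

theorem image_loop (hc : c ≠ 0) (hre0 : (c ^ 2 / 2).re = 0) (h : IsRayLift (c ^ 2 / 2) S ζ)
    (hS : 0 < S) (hre : ∀ s ∈ Ioo 0 S, (ζ s).re < 0)
    (hn : c ^ 2 / 2 * S = n * (2 * π * Complex.I)) :
    loop c S ζ '' Icc 0 S = {z | loopGauge (1 - c * z / 2) = 1} := by
  have hIcc : loop c S ζ '' Icc 0 S = (fun s => ofLog c (ζ s)) '' Ico 0 S := by
    have hS0 : loop c S ζ S = ofLog c (ζ 0) := by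
      rw [loop_of_le c ζ le_rfl, h.zero, ofLog_zero]
    rw [← Ico_insert_right hS.le, image_insert_eq, hS0,
      image_congr fun s (hs : s ∈ Ico 0 S) => loop_of_lt c ζ hs.2]
    exact insert_eq_of_mem ⟨0, ⟨le_rfl, hS⟩, rfl⟩
  have hexp := h.image_exp_Ico hre0 hS hre hn (by simpa using hc)
  rw [hIcc]
  ext z
  rw [mem_ofPred_eq, ← mem_ofPred_eq (p := fun q => loopGauge q = 1), ← hexp]
  simp only [mem_image, ← eq_ofLog_iff hc, eq_comm (a := z)]

theorem isBlowUpPair_loop (hc : c ≠ 0) {ζp : ℝ → ℂ}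
    (hp : ∀ S, IsRayLift (c ^ 2 / 2) S ζp ∧ ∀ s ∈ Ioo 0 S, 0 < (ζp s).re ∧ |(ζp s).im| < π)
    (h : IsRayLift (c ^ 2 / 2) S ζ) (hS : 0 < S) (hre : ∀ s ∈ Ioo 0 S, (ζ s).re < 0)
    (hn : c ^ 2 / 2 * S = n * (2 * π * Complex.I)) :
    IsBlowUpPair (linearDriver c) (fun s => ofLog c (ζp s)) (loop c S ζ) S := by
  refine isBlowUpPair_of_isReverseTrajectory
    (fun T => (hp (|T| + 1)).1.isReverseTrajectory hc (by positivity)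
      (by linarith [le_abs_self T]))
    (fun T hT => ?_) (by simp [(hp 0).1.zero, ofLog_zero]) (loop_zero h hS)
    (continuousOn_loop h hS hre hn) (EReal.coe_pos.2 hS) (fun T h0T hT => ?_)
    fun T hT => loop_of_le c ζ (EReal.coe_le_coe_iff.1 hT)
  · have hTS := EReal.coe_lt_coe_iff.1 hT
    exact (h.isReverseTrajectory hc hS hTS).congr hS hTS fun s hs => loop_of_lt c ζ hs.2
  · rw [loop_of_lt c ζ (EReal.coe_lt_coe_iff.1 hT)]
    exact ofLog_ne_of_re hc ((hp (T + 1)).2 T ⟨h0T, lt_add_one T⟩).1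
      (hre T ⟨h0T, EReal.coe_lt_coe_iff.1 hT⟩)

end Loop

theorem exists_isBlowUpPair_of_eq {c : ℂ} (h : c.re ^ 2 - c.im ^ 2 = 0) (hc : c ≠ 0) :
    ∃ γp γm, IsBlowUpPair (linearDriver c) γp γm (4 * π / ‖c‖ ^ 2 : ℝ) ∧
      IsExoticCurve (linearDriver c) (twoSided γp γm) (4 * π / ‖c‖ ^ 2) := by
  set S := 4 * π / ‖c‖ ^ 2
  have hS : 0 < S := by positivity
  have ha : (c ^ 2 / 2).re = 0 := by rw [sq_half_re, h, zero_div]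
  have ha0 : c ^ 2 / 2 ≠ 0 := by simpa using hc
  have haS : ‖c ^ 2 / 2‖ * S = 2 * π := by
    have hc' : ‖c‖ ≠ 0 := norm_ne_zero_iff.2 hc
    rw [norm_div, norm_pow, Complex.norm_ofNat]
    simp only [S]
    field_simp
    ring
  obtain ⟨n, hn⟩ := exists_mul_eq_int_mul ha haS
  obtain ⟨ζp, hp⟩ := exists_isRayLift_right ha.le ha0
  obtain ⟨ζm, hm⟩ := exists_isRayLift_left ha.le
  obtain ⟨hlift, hre⟩ := hm S fun s hs => mul_ne_int_mul_of_mem_Ioo haS hs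
  have hpair := isBlowUpPair_loop hc hp hlift hS hre hn
  refine ⟨_, _, hpair, hpair.isExoticCurve (continuous_linearDriver c).continuousOn
    (linearDriver_zero c) hS (tendsto_ofLog_cobounded_of_re_nonpos hc ha0 hp)
    (isStarGauge_loopGauge hc) (fun t ht => ?_) (image_loop hc ha hlift hS hre hn)⟩
  rw [one_sub_mul_ofLog hc]
  refine one_le_loopGauge_exp (Eq.ge ?_)
  rcases ht.eq_or_lt with rfl | ht
  · rw [(hp 0).1.zero, potential_zero, Complex.zero_re]
  · rw [IsRayLift.potential_eq_of_pos (fun S => (hp S).1) ht, Complex.re_mul_ofReal, ha, zero_mul]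

theorem not_tendsto_cobounded_of_tendsto_nhds {α E : Type*} [PseudoMetricSpace E] {l : Filter α}
    [l.NeBot] {f : α → E} {p : E} (h : Tendsto f l (𝓝 p)) :
    ¬ Tendsto f l (Bornology.cobounded E) :=
  h.not_tendsto (Metric.disjoint_nhds_cobounded p)

section twoSided

variable {γp γm : ℝ → ℂ} {l : Filter ℂ}

theorem tendsto_twoSided_iff : Tendsto (twoSided γp γm) atTop l ↔ Tendsto γp atTop l :=
  tendsto_congr' ((eventually_ge_atTop 0).mono fun _ ht => twoSided_of_nonneg ht)

theorem tendsto_twoSided_neg_iff :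
    Tendsto (fun t => twoSided γp γm (-t)) atTop l ↔ Tendsto γm atTop l :=
  tendsto_congr' ((eventually_gt_atTop 0).mono fun _ ht => twoSided_neg_of_pos ht)

end twoSided

theorem WindsInfinitely.congr {η η' : ℝ → ℂ} {p : ℂ} (h : WindsInfinitely η p)
    (heq : EqOn η' η (Ici 0)) : WindsInfinitely η' p := by
  obtain ⟨θ, hcont, harg, hlim⟩ := h
  exact ⟨θ, hcont, fun t ht => heq ht ▸ harg t ht, hlim⟩

namespace IsBlowUpPair

variable {lam γp γm γ : ℝ → ℂ} {p : ℂ}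

theorem isSimpleCurve (h : IsBlowUpPair lam γp γm ⊤) (hlam : ContinuousOn lam (Ici 0))
    (hp : Tendsto γp atTop (Bornology.cobounded ℂ))
    (hm : Tendsto γm atTop (Bornology.cobounded ℂ)) : IsSimpleCurve lam (twoSided γp γm) where
  creates := h.creates hlam
  injective := h.injective hlam
  tendsto_pos := tendsto_twoSided_iff.2 hp
  tendsto_neg := tendsto_twoSided_neg_iff.2 hm

theorem isSimpleCurveEndingAt (h : IsBlowUpPair lam γp γm ⊤) (hlam : ContinuousOn lam (Ici 0))
    (hp : Tendsto γp atTop (Bornology.cobounded ℂ)) (hm : Tendsto γm atTop (𝓝 p))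
    (hne : ∀ s, γp s ≠ p ∧ γm s ≠ p) : IsSimpleCurveEndingAt lam (twoSided γp γm) p where
  creates := h.creates hlam
  injective := h.injective hlam
  tendsto_pos := tendsto_twoSided_iff.2 hp
  tendsto_neg := tendsto_twoSided_neg_iff.2 hm
  notMem := by
    rintro ⟨t, ht⟩
    rcases le_total 0 t with h0 | h0
    · rw [twoSided_of_nonneg h0] at ht
      exact (hne t).1 ht
    · rw [← neg_neg t, twoSided_neg h.pos_zero_eq_neg_zero (neg_nonneg.2 h0)] at ht
      exact (hne (-t)).2 ht

theorem tendsto_neg_cobounded (h : IsBlowUpPair lam γp γm ⊤) (hlam : ContinuousOn lam (Ici 0))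
    (hγ : IsSimpleCurve lam γ) : Tendsto γm atTop (Bornology.cobounded ℂ) := by
  rcases h.eq_twoSided_or_eq_twoSided hlam hγ.creates hγ.injective with rfl | rfl
  · exact tendsto_twoSided_neg_iff.1 hγ.tendsto_neg
  · exact tendsto_twoSided_iff.1 hγ.tendsto_pos

theorem eq_twoSided_of_isSimpleCurveEndingAt (h : IsBlowUpPair lam γp γm ⊤)
    (hlam : ContinuousOn lam (Ici 0)) (hp : Tendsto γp atTop (Bornology.cobounded ℂ))
    (hγ : IsSimpleCurveEndingAt lam γ p) : γ = twoSided γp γm := by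
  refine (h.eq_twoSided_or_eq_twoSided hlam hγ.creates hγ.injective).resolve_right ?_
  rintro rfl
  exact not_tendsto_cobounded_of_tendsto_nhds (tendsto_twoSided_neg_iff.1 hγ.tendsto_neg) hp

end IsBlowUpPair

section LinearDriver

variable {c p : ℂ} {γ : ℝ → ℂ} {T : ℝ}

theorem phase_trichotomy (c : ℂ) : (0 < c.re ^ 2 - c.im ^ 2 ∨ c = 0) ∨
    c.re ^ 2 - c.im ^ 2 < 0 ∨ c.re ^ 2 - c.im ^ 2 = 0 ∧ c ≠ 0 := by
  by_cases hc : c = 0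
  · exact Or.inl (Or.inr hc)
  · rcases lt_trichotomy (c.re ^ 2 - c.im ^ 2) 0 with h | h | h
    exacts [Or.inr (Or.inl h), Or.inr (Or.inr ⟨h, hc⟩), Or.inl (Or.inl h)]

theorem exists_isBlowUpPair_of_pos_or_eq_zero (h : 0 < c.re ^ 2 - c.im ^ 2 ∨ c = 0) :
    ∃ γp γm, IsBlowUpPair (linearDriver c) γp γm ⊤ ∧
      Tendsto γp atTop (Bornology.cobounded ℂ) ∧ Tendsto γm atTop (Bornology.cobounded ℂ) := by
  rcases h with h | rfl
  exacts [exists_isBlowUpPair_of_pos h, exists_isBlowUpPair_zero]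

theorem exists_createsTwoSidedCurve (c : ℂ) :
    ∃ γ, CreatesTwoSidedCurve (linearDriver c) γ := by
  have hcont := (continuous_linearDriver c).continuousOn (s := Ici 0)
  rcases phase_trichotomy c with h | h | h
  · obtain ⟨γp, γm, hpair, -⟩ := exists_isBlowUpPair_of_pos_or_eq_zero h
    exact ⟨_, hpair.creates hcont⟩
  · obtain ⟨γp, γm, hpair, -⟩ := exists_isBlowUpPair_of_neg h
    exact ⟨_, hpair.creates hcont⟩
  · obtain ⟨γp, γm, hpair, -⟩ := exists_isBlowUpPair_of_eq h.1 h.2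
    exact ⟨_, hpair.creates hcont⟩

theorem not_injective_of_eq (h : c.re ^ 2 - c.im ^ 2 = 0) (hc : c ≠ 0)
    (hγ : CreatesTwoSidedCurve (linearDriver c) γ) : ¬ Function.Injective γ := fun hinj => by
  obtain ⟨γp, γm, hpair, -⟩ := exists_isBlowUpPair_of_eq h hc
  exact EReal.coe_ne_top _
    (hpair.lifetime_eq_top_of_injective (continuous_linearDriver c).continuousOn hγ hinj)

theorem exists_isSimpleCurve_iff (c : ℂ) : (∃ γ, IsSimpleCurve (linearDriver c) γ) ↔
    0 < c.re ^ 2 - c.im ^ 2 ∨ c = 0 := by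
  have hcont := (continuous_linearDriver c).continuousOn (s := Ici 0)
  constructor
  · rintro ⟨γ, hγ⟩
    rcases phase_trichotomy c with h | h | h
    · exact h
    · obtain ⟨γp, γm, hpair, -, hm, -⟩ := exists_isBlowUpPair_of_neg h
      exact absurd (hpair.tendsto_neg_cobounded hcont hγ)
        (not_tendsto_cobounded_of_tendsto_nhds hm)
    · exact absurd hγ.injective (not_injective_of_eq h.1 h.2 hγ.creates)
  · intro h
    obtain ⟨γp, γm, hpair, hp, hm⟩ := exists_isBlowUpPair_of_pos_or_eq_zero h
    exact ⟨_, hpair.isSimpleCurve hcont hp hm⟩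

theorem IsSimpleCurveEndingAt.re_sq_sub_im_sq_neg
    (hγ : IsSimpleCurveEndingAt (linearDriver c) γ p) : c.re ^ 2 - c.im ^ 2 < 0 := by
  rcases phase_trichotomy c with h | h | h
  · obtain ⟨γp, γm, hpair, hp, hm⟩ := exists_isBlowUpPair_of_pos_or_eq_zero h
    obtain rfl := hpair.eq_twoSided_of_isSimpleCurveEndingAt
      (continuous_linearDriver c).continuousOn hp hγ
    exact absurd hm
      (not_tendsto_cobounded_of_tendsto_nhds (tendsto_twoSided_neg_iff.1 hγ.tendsto_neg))
  · exact h
  · exact absurd hγ.injective (not_injective_of_eq h.1 h.2 hγ.creates)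

theorem exists_isSimpleCurveEndingAt_iff (c : ℂ) :
    (∃ γ p, IsSimpleCurveEndingAt (linearDriver c) γ p) ↔ c.re ^ 2 - c.im ^ 2 < 0 := by
  refine ⟨fun ⟨_, _, hγ⟩ => hγ.re_sq_sub_im_sq_neg, fun h => ?_⟩
  obtain ⟨γp, γm, hpair, hp, hm, hne, -⟩ := exists_isBlowUpPair_of_neg h
  exact ⟨_, _, hpair.isSimpleCurveEndingAt (continuous_linearDriver c).continuousOn hp hm hne⟩

theorem IsSimpleCurveEndingAt.spirals (hγ : IsSimpleCurveEndingAt (linearDriver c) γ p) :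
    p = 2 / c ∧ (c.re ≠ 0 → WindsInfinitely (fun t => γ (-t)) p) ∧
      (c.re = 0 → ∀ t : ℝ, 0 ≤ t → γ (-t) ∈ segment ℝ 0 p) := by
  obtain ⟨γp, γm, hpair, hp, hm, -, hwinds, hsegment⟩ :=
    exists_isBlowUpPair_of_neg hγ.re_sq_sub_im_sq_neg
  obtain rfl := hpair.eq_twoSided_of_isSimpleCurveEndingAt
    (continuous_linearDriver c).continuousOn hp hγ
  obtain rfl := tendsto_nhds_unique (tendsto_twoSided_neg_iff.1 hγ.tendsto_neg) hm
  have hneg : ∀ t ≥ 0, twoSided γp γm (-t) = γm t := fun t ht =>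
    twoSided_neg hpair.pos_zero_eq_neg_zero ht
  exact ⟨rfl, fun hre => (hwinds hre).congr hneg, fun hre t ht => hneg t ht ▸ hsegment hre t ht⟩

theorem IsExoticCurve.re_sq_sub_im_sq_eq_zero (hγ : IsExoticCurve (linearDriver c) γ T) :
    c.re ^ 2 - c.im ^ 2 = 0 ∧ c ≠ 0 := by
  have hfinite : ∀ {γp γm}, ¬ IsBlowUpPair (linearDriver c) γp γm ⊤ := fun hpair =>
    (EReal.coe_ne_top T)
      (hpair.lifetime_eq_of_isExoticCurve (continuous_linearDriver c).continuousOn hγ).symm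
  rcases phase_trichotomy c with h | h | h
  · obtain ⟨γp, γm, hpair, -⟩ := exists_isBlowUpPair_of_pos_or_eq_zero h
    exact absurd hpair hfinite
  · obtain ⟨γp, γm, hpair, -⟩ := exists_isBlowUpPair_of_neg h
    exact absurd hpair hfinite
  · exact h

theorem exists_isExoticCurve_iff (c : ℂ) : (∃ γ T, IsExoticCurve (linearDriver c) γ T) ↔
    c.re ^ 2 - c.im ^ 2 = 0 ∧ c ≠ 0 := by
  refine ⟨fun ⟨_, _, hγ⟩ => hγ.re_sq_sub_im_sq_eq_zero, fun h => ?_⟩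
  obtain ⟨γp, γm, -, hγ⟩ := exists_isBlowUpPair_of_eq h.1 h.2
  exact ⟨_, _, hγ⟩

theorem IsExoticCurve.time_eq (hγ : IsExoticCurve (linearDriver c) γ T) :
    T = 4 * π / ‖c‖ ^ 2 := by
  obtain ⟨h, hc⟩ := hγ.re_sq_sub_im_sq_eq_zero
  obtain ⟨γp, γm, hpair, -⟩ := exists_isBlowUpPair_of_eq h hc
  exact EReal.coe_injective
    (hpair.lifetime_eq_of_isExoticCurve (continuous_linearDriver c).continuousOn hγ).symm

end LinearDriver

theorem mainTheorem1 :
    -- every complex linear driver creates a two-sided curve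
    (∀ c : ℂ, ∃ γ : ℝ → ℂ, CreatesTwoSidedCurve (linearDriver c) γ) ∧
    -- (i) the simple phase
    (∀ c : ℂ, (∃ γ : ℝ → ℂ, IsSimpleCurve (linearDriver c) γ) ↔
      (0 < c.re ^ 2 - c.im ^ 2 ∨ c = 0)) ∧
    -- (ii) the phase in which one end of the simple curve spirals
    (∀ c : ℂ, (∃ (γ : ℝ → ℂ) (p : ℂ), IsSimpleCurveEndingAt (linearDriver c) γ p) ↔
      c.re ^ 2 - c.im ^ 2 < 0) ∧
    (∀ (c : ℂ) (γ : ℝ → ℂ) (p : ℂ), IsSimpleCurveEndingAt (linearDriver c) γ p →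
      p = 2 / c ∧
      (c.re ≠ 0 → WindsInfinitely (fun t => γ (-t)) p) ∧
      (c.re = 0 → ∀ t : ℝ, 0 ≤ t → γ (-t) ∈ segment ℝ 0 p)) ∧
    -- (iii) the exotic phase
    (∀ c : ℂ, (∃ (γ : ℝ → ℂ) (T : ℝ), IsExoticCurve (linearDriver c) γ T) ↔
      (c.re ^ 2 - c.im ^ 2 = 0 ∧ c ≠ 0)) ∧
    (∀ (c : ℂ) (γ : ℝ → ℂ) (T : ℝ), IsExoticCurve (linearDriver c) γ T →
      T = 4 * Real.pi / ‖c‖ ^ 2) :=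
  ⟨exists_createsTwoSidedCurve, exists_isSimpleCurve_iff, exists_isSimpleCurveEndingAt_iff,
    fun _ _ _ hγ => hγ.spirals, exists_isExoticCurve_iff, fun _ _ _ hγ => hγ.time_eq⟩
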